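/- All graphs are simple, finite and undirected. A planar emulator of a graph $G$ is a finite planar graph $H$ for which there is a graph homomorphism $\varphi$ from $H$ to $G$ that maps $V(H)$ onto $V(G)$ and that is locally surjective: for every vertex $x\in V(H)$, the neighbors of $x$ in $H$ are mapped by $\varphi$ surjectively onto the neighbors of $\varphi(x)$ in $G$. **Theorem.** The complete bipartite graph $K_{3,5}$ has no planar emulator. -/

import Mathlib

universe u v

/-- The Euclidean plane `ℝ²`. -/
abbrev Plane : Type := EuclideanSpace ℝ (Fin 2)

/-- `A` is a simple arc in the plane with ends `p` and `q`: the image of a continuous injective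
map of the unit interval that starts at `p` and ends at `q`. -/
def IsArcBetween (A : Set Plane) (p q : Plane) : Prop :=
  ∃ γ : unitInterval → Plane,
    Continuous γ ∧ Function.Injective γ ∧ γ 0 = p ∧ γ 1 = q ∧ Set.range γ = A

/-- A drawing of the graph `H` in the plane without crossings: distinct vertices are distinct
points, each edge is a simple arc between (the points of) its two ends that contains no other
vertex, and two distinct edges meet only in common ends. The values of `arc` on pairs
that are not edges of `H` play no role. -/
structure PlaneDrawing {W : Type u} (H : SimpleGraph W) where
  /-- the point of a vertex -/
  point : W → Plane
  /-- the arc of an edge -/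
  arc : Sym2 W → Set Plane
  point_injective : Function.Injective point
  isArcBetween : ∀ x y : W, H.Adj x y → IsArcBetween (arc s(x, y)) (point x) (point y)
  mem_of_point_mem_arc : ∀ e ∈ H.edgeSet, ∀ w : W, point w ∈ arc e → w ∈ e
  common_end_of_mem_arcs : ∀ e ∈ H.edgeSet, ∀ f ∈ H.edgeSet, e ≠ f →
    ∀ z : Plane, z ∈ arc e → z ∈ arc f → ∃ w : W, w ∈ e ∧ w ∈ f ∧ point w = z

/-- A graph is planar if it can be drawn in the plane without crossings. -/
def IsPlanar {W : Type u} (H : SimpleGraph W) : Prop :=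
  Nonempty (PlaneDrawing H)

/-- An emulator projection: a graph homomorphism `φ` from `H` onto `G` that maps, for every
vertex `x` of `H`, the neighbours of `x` onto the neighbours of `φ x`. -/
def IsEmulatorProjection {W : Type u} {V : Type v} {H : SimpleGraph W} {G : SimpleGraph V}
    (φ : H →g G) : Prop :=
  Function.Surjective φ ∧
    ∀ x : W, Set.SurjOn φ (H.neighborSet x) (G.neighborSet (φ x))

/-- `G` has a planar emulator: a finite planar graph with an emulator projection to `G`. -/
def HasPlanarEmulator {V : Type v} (G : SimpleGraph V) : Prop :=
  ∃ (W : Type u) (_ : Finite W) (H : SimpleGraph W) (φ : H →g G),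
    IsPlanar H ∧ IsEmulatorProjection φ

/-!
The proof has a geometric and a combinatorial half, which meet in the notion of a plane map
(`IsPlaneMap`): a rotation system for which every flow is the coboundary of a function on the faces.
This is the homological way to say that the surface is a sphere, and Euler's inequality
`E + 2 ≤ V + F` follows from it by counting dimensions (`IsPlaneMap.euler`).

A drawing of a finite graph with arbitrary arcs gives a plane map without the Jordan curve theorem.
Cut each arc into thirds, and take a fine square lattice.  The lattice points near the first thirds
at a vertex, together with lattice walks along the middle thirds, are disjoint connected sets that
exhibit the graph as a minor of the lattice (`IsPlanar.exists_lattice_branch_sets`).  A finite part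
of the lattice is a plane map, since a flow on the lattice is the coboundary of the function that
sums up the horizontal flow below a unit square (`exists_isPlaneMap_lattice`), and plane maps are
closed under deletion and contraction (`IsPlaneMap.contract_fibres`).

Now let `H` be a planar emulator of `K_{3,5}`.  Call the vertices over the part of size three, which
have degree at least five, the A-vertices, coloured by their images, and those over the part of size
five, which have degree at least three, the B-vertices; all three colours occur around a B-vertex.
Euler's inequality says that the charges `4 d - 12` of the B-vertices, `2 d - 12` of the A-vertices
(`d` being the degree) and at least `2` for each corner of an A-vertex on a face that is not a
quadrangle have a negative total.  But charge can be moved from B-vertices to A-vertices so that no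
vertex is left with a negative charge.  A B-vertex gives `cornerWeight x c y` to a neighbour of
colour `c` that lies between neighbours of colours `x` and `y`, and it can afford this
(`sum_cornerWeight_add_le`).  An A-vertex is in need only if it has degree five and all its faces
are quadrangles, and then it obtains at least two units because five is odd
(`two_le_sum_cornerWeight_of_quadrangles`).
-/

open Equiv

/-! ### Bypassing a point in a permutation -/

/-- The permutation obtained from `σ` by bypassing `e`: the predecessor of `e` is sent to the
successor of `e`, and `e` becomes a fixed point. -/
def Equiv.Perm.bypass {D : Type*} [DecidableEq D] (σ : Perm D) (e : D) : Perm D :=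
  swap e (σ e) * σ

section Bypass

variable {D : Type*} [DecidableEq D] (σ : Perm D) {e : D}

theorem Equiv.Perm.bypass_apply_of_ne {d : D} (hd : d ≠ e) (h : σ d ≠ e) :
    σ.bypass e d = σ d := by
  rw [Perm.bypass, Perm.mul_apply, swap_apply_of_ne_of_ne h (fun h' => hd (σ.injective h'))]

theorem Equiv.Perm.bypass_apply_of_eq {d : D} (h : σ d = e) :
    σ.bypass e d = σ e := by
  rw [Perm.bypass, Perm.mul_apply, h, swap_apply_left]

theorem Equiv.Perm.bypass_ne {d : D} (hd : d ≠ e) : σ.bypass e d ≠ e := by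
  by_cases h : σ d = e
  · rw [σ.bypass_apply_of_eq h]
    intro h'
    exact hd (σ.injective (h.trans h'.symm))
  · rwa [σ.bypass_apply_of_ne hd h]

theorem Equiv.Perm.SameCycle.of_step {D : Type*} {σ τ : Perm D}
    (h : ∀ x, σ.SameCycle x (τ x)) {x y : D} (hxy : τ.SameCycle x y) : σ.SameCycle x y := by
  have key : ∀ (n : ℕ) (x : D), σ.SameCycle x ((τ ^ n) x) := by
    intro n
    induction n with
    | zero => intro x; exact .refl _ _
    | succ n ih =>
      intro x
      rw [pow_succ', Perm.mul_apply]
      exact (ih x).trans (h _)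
  obtain ⟨i, rfl⟩ := hxy
  obtain ⟨n, rfl | rfl⟩ := i.eq_nat_or_neg
  · simpa using key n x
  · have := key n ((τ ^ (-(n : ℤ))) x)
    rw [← Perm.mul_apply, zpow_neg, zpow_natCast, mul_inv_cancel, Perm.one_apply] at this
    rw [zpow_neg, zpow_natCast]
    exact this.symm

theorem Equiv.Perm.sameCycle_bypass_iff {x y : D} (hx : x ≠ e) (hy : y ≠ e) :
    (σ.bypass e).SameCycle x y ↔ σ.SameCycle x y := by
  constructor
  · refine Perm.SameCycle.of_step fun z => ?_
    by_cases hz : z = e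
    · subst hz
      rw [Perm.bypass, Perm.mul_apply, swap_apply_right]
    · by_cases h : σ z = e
      · rw [σ.bypass_apply_of_eq h, ← h]
        exact ⟨2, by simp [zpow_ofNat, pow_two]⟩
      · rw [σ.bypass_apply_of_ne hz h]
        exact ⟨1, by simp⟩
  · have key : ∀ (n : ℕ) (x : D), x ≠ e → (σ ^ n) x ≠ e →
        (σ.bypass e).SameCycle x ((σ ^ n) x) := by
      intro n
      induction n using Nat.strong_induction_on with
      | _ n ih =>
        intro x hx hn
        match n with
        | 0 => exact .refl _ _
        | n + 1 =>
          have hstep : (σ ^ (n + 1)) x = (σ ^ n) (σ x) := by rw [pow_succ, Perm.mul_apply]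
          by_cases h : σ x = e
          · match n with
            | 0 => simp [h] at hn
            | n + 1 =>
              have hstep2 : (σ ^ (n + 1 + 1)) x = (σ ^ n) (σ e) := by
                rw [hstep, pow_succ, Perm.mul_apply, h]
              have hne : σ e ≠ e := fun h' => hx (σ.injective (h.trans h'.symm))
              have h1 := ih n (by omega) (σ e) hne (hstep2 ▸ hn)
              rw [hstep2]
              refine Perm.SameCycle.trans ⟨1, ?_⟩ h1
              simp [σ.bypass_apply_of_eq h]
          · have h1 := ih n (by omega) (σ x) h (hstep ▸ hn)
            rw [hstep]
            refine Perm.SameCycle.trans ⟨1, ?_⟩ h1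
            simp [σ.bypass_apply_of_ne hx h]
    rintro ⟨i, rfl⟩
    obtain ⟨n, rfl | rfl⟩ := i.eq_nat_or_neg
    · rw [zpow_natCast] at hy ⊢
      exact key n x hx hy
    · have := key n ((σ ^ (-(n : ℤ))) x) hy
        (by rwa [← Perm.mul_apply, zpow_neg, zpow_natCast, mul_inv_cancel, Perm.one_apply])
      rw [← Perm.mul_apply, zpow_neg, zpow_natCast, mul_inv_cancel, Perm.one_apply] at this
      rw [zpow_neg, zpow_natCast]
      exact this.symm

/-- If the increments of `f` along `σ` are the values of `c`, and `c` vanishes at the bypassed point,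
then the same holds along the bypass. -/
theorem Equiv.Perm.bypass_potential {f c : D → ℚ} (he : c e = 0) {S : Finset D} (heS : e ∈ S)
    (h : ∀ d ∈ S, f (σ d) = f d + c (σ d)) {d : D} (hd : d ∈ S) (hde : d ≠ e) :
    f (σ.bypass e d) = f d + c (σ.bypass e d) := by
  by_cases h' : σ d = e
  · have := h d hd
    rw [h', he, add_zero] at this
    rw [σ.bypass_apply_of_eq h', h e heS, this]
  · rw [σ.bypass_apply_of_ne hde h', h d hd]

/-- Multiplying by the transposition of two points in different cycles joins these cycles. -/
theorem Equiv.Perm.sameCycle_mul_swap_self {e e' : D} (hne : ¬ σ.SameCycle e e')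
    {S : Finset D} (heS : e ∈ S) (hS : ∀ d ∈ S, σ d ∈ S) :
    (σ * swap e e').SameCycle e e' := by
  have hpow : ∀ n : ℕ, (σ ^ n) e ∈ S := by
    intro n
    induction n with
    | zero => simpa
    | succ n ih => rw [pow_succ', Perm.mul_apply]; exact hS _ ih
  -- the orbit of `e` is finite, so `σ` returns to `e`
  have hex : ∃ n : ℕ, 0 < n ∧ (σ ^ n) e = e := by
    obtain ⟨a, b, hab, heq⟩ := Finite.exists_ne_map_eq_of_infinite
      (fun n : ℕ => (⟨(σ ^ n) e, hpow n⟩ : S))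
    have heq' : (σ ^ a) e = (σ ^ b) e := congrArg Subtype.val heq
    have main : ∀ a b : ℕ, a < b → (σ ^ a) e = (σ ^ b) e → ∃ n : ℕ, 0 < n ∧ (σ ^ n) e = e := by
      intro a b hlt h
      refine ⟨b - a, by omega, ?_⟩
      apply (σ ^ a).injective
      rw [← Perm.mul_apply, ← pow_add, h]
      congr 2
      omega
    rcases lt_or_gt_of_ne hab with h | h
    · exact main a b h heq'
    · exact main b a h heq'.symm
  classical
  let n := Nat.find hex
  have hn : 0 < n ∧ (σ ^ n) e = e := Nat.find_spec hex
  have key : ∀ k : ℕ, k + 1 ≤ n → ((σ * swap e e') ^ (k + 1)) e' = (σ ^ (k + 1)) e := by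
    intro k
    induction k with
    | zero => intro _; simp
    | succ k ih =>
      intro hk
      rw [pow_succ', Perm.mul_apply, ih (by omega), Perm.mul_apply, swap_apply_of_ne_of_ne,
        ← Perm.mul_apply, ← pow_succ']
      · intro h
        exact Nat.find_min hex (m := k + 1) (by omega) ⟨by omega, h⟩
      · intro h
        exact hne ⟨(k + 1 : ℕ), by rw [zpow_natCast]; exact h⟩
  refine Perm.SameCycle.symm ⟨n, ?_⟩
  have := key (n - 1) (by omega)
  rw [Nat.sub_add_cancel hn.1] at this
  rw [zpow_natCast, this, hn.2]

end Bypass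

/-! ### Plane maps, deletion and contraction -/

open scoped Classical in
/-- A finite map on the sphere, given by its darts (directed edges).  `S` is the set of darts,
`α` reverses a dart, `σ` sends a dart to the next one around its origin, and `o` labels a dart by
its origin.  That the surface is a sphere is expressed homologically: every flow `c`, that is,
every antisymmetric function on the darts with zero net outflow at each vertex, is the difference
of the values on the left and on the right of each dart of a function on the faces.  Such a
function is encoded as a function `f` on the darts, `f d` being the value on the left of `d`. -/
structure IsPlaneMap {D V : Type*} (α : D → D) (S : Finset D) (σ : Perm D) (o : D → V) :
    Prop where
  rev_mem : ∀ d ∈ S, α d ∈ S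
  rot_mem : ∀ d ∈ S, σ d ∈ S
  sameCycle_iff : ∀ d ∈ S, ∀ d' ∈ S, σ.SameCycle d d' ↔ o d = o d'
  exists_potential : ∀ c : D → ℚ, (∀ d ∈ S, c (α d) = -c d) →
    (∀ v, ∑ d ∈ S with o d = v, c d = 0) →
    ∃ f : D → ℚ, ∀ d ∈ S, f (α d) = f d - c d ∧ f (σ d) = f d + c (σ d)

namespace IsPlaneMap

variable {D V : Type*} {α : D → D} {S : Finset D} {σ : Perm D} {o : D → V}

open scoped Classical in
/-- The common part of deleting and of contracting the edge of `e`: both bypass the two darts of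
the edge, in the rotation `σ` for a deletion and in the rotation around the joined vertex for a
contraction. -/
theorem bypass_edge (hα : ∀ d, α (α d) = d) (hrev : ∀ d ∈ S, α d ∈ S)
    (hrot : ∀ d ∈ S, σ d ∈ S) (hcyc : ∀ d ∈ S, ∀ d' ∈ S, σ.SameCycle d d' ↔ o d = o d')
    {e : D} (he : e ∈ S)
    (hpot : ∀ c : D → ℚ, (∀ d ∈ S, c (α d) = -c d) → c e = 0 → c (α e) = 0 →
      (∀ v, ∑ d ∈ S with o d = v, c d = 0) →
      ∃ f : D → ℚ, (∀ d ∈ S, d ≠ e → d ≠ α e → f (α d) = f d - c d) ∧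
        ∀ d ∈ S, f (σ d) = f d + c (σ d)) :
    IsPlaneMap α ((S.erase e).erase (α e)) ((σ.bypass e).bypass (α e)) o := by
  have hrot' : ∀ d ∈ S, σ.bypass e d ∈ S := by
    intro d hd
    by_cases h1 : d = e
    · subst h1
      rw [Perm.bypass, Perm.mul_apply, swap_apply_right]
      exact hd
    · by_cases h2 : σ d = e
      · rw [σ.bypass_apply_of_eq h2]
        exact hrot e he
      · rw [σ.bypass_apply_of_ne h1 h2]
        exact hrot d hd
  refine ⟨?_, ?_, ?_, ?_⟩
  · intro d hd
    simp only [Finset.mem_erase] at hd ⊢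
    refine ⟨fun h => hd.2.1 ?_, fun h => hd.1 ?_, hrev d hd.2.2⟩
    · rw [← hα d, h, hα]
    · rw [← hα d, h]
  · intro d hd
    simp only [Finset.mem_erase] at hd ⊢
    refine ⟨Perm.bypass_ne _ hd.1, ?_, ?_⟩
    · by_cases h : σ.bypass e d = α e
      · rw [Perm.bypass_apply_of_eq _ h]
        by_cases h' : α e = e
        · exact absurd (h.trans h') (σ.bypass_ne hd.2.1)
        · exact σ.bypass_ne h'
      · rw [Perm.bypass_apply_of_ne _ hd.1 h]
        exact σ.bypass_ne hd.2.1
    · by_cases h : σ.bypass e d = α e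
      · rw [Perm.bypass_apply_of_eq _ h]
        exact hrot' _ (hrev e he)
      · rw [Perm.bypass_apply_of_ne _ hd.1 h]
        exact hrot' _ hd.2.2
  · intro d hd d' hd'
    simp only [Finset.mem_erase] at hd hd'
    rw [Perm.sameCycle_bypass_iff _ hd.1 hd'.1, Perm.sameCycle_bypass_iff _ hd.2.1 hd'.2.1]
    exact hcyc d hd.2.2 d' hd'.2.2
  · intro c hc hsum
    have hmem : ∀ d ∈ S, d ≠ e → d ≠ α e → d ∈ (S.erase e).erase (α e) := by
      intro d hd h1 h2
      simp [hd, h1, h2]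
    let c₀ : D → ℚ := fun d => if d = e ∨ d = α e then 0 else c d
    obtain ⟨f, hf1, hf2⟩ := hpot c₀ (by
        intro d hd
        by_cases h : d = e ∨ d = α e
        · have h' : α d = e ∨ α d = α e := by
            rcases h with rfl | rfl
            · exact Or.inr rfl
            · exact Or.inl (hα _)
          simp only [c₀, if_pos h, if_pos h', neg_zero]
        · have h' : ¬ (α d = e ∨ α d = α e) := by
            rintro (h' | h')
            · exact h (Or.inr (by rw [← h', hα]))
            · exact h (Or.inl (by rw [← hα d, h', hα]))
          simp only [c₀, if_neg h, if_neg h']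
          push Not at h
          exact hc d (hmem d hd h.1 h.2)) (by simp [c₀]) (by simp [c₀]) (by
        intro v
        rw [← hsum v]
        symm
        rw [Finset.sum_filter, Finset.sum_filter]
        have hsub : (S.erase e).erase (α e) ⊆ S :=
          (Finset.erase_subset _ _).trans (Finset.erase_subset _ _)
        rw [← Finset.sum_subset hsub]
        · refine Finset.sum_congr rfl fun d hd => ?_
          simp only [Finset.mem_erase] at hd
          simp [c₀, hd.1, hd.2.1]
        · intro d hd hd'
          have : d = e ∨ d = α e := by
            by_contra h
            push Not at h
            exact hd' (hmem d hd h.1 h.2)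
          simp [c₀, this])
    refine ⟨f, fun d hd => ?_⟩
    have hd0 := hd
    simp only [Finset.mem_erase] at hd
    have hc₀ : ∀ d, d ≠ e → d ≠ α e → c₀ d = c d := by
      intro d h1 h2
      simp [c₀, h1, h2]
    refine ⟨by rw [hf1 d hd.2.2 hd.2.1 hd.1, hc₀ d hd.2.1 hd.1], ?_⟩
    have hn1 : (σ.bypass e).bypass (α e) d ≠ α e := Perm.bypass_ne _ hd.1
    have hn2 : (σ.bypass e).bypass (α e) d ≠ e := by
      by_cases h : σ.bypass e d = α e
      · rw [Perm.bypass_apply_of_eq _ h]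
        by_cases h' : α e = e
        · exact absurd (h.trans h') (σ.bypass_ne hd.2.1)
        · exact σ.bypass_ne h'
      · rw [Perm.bypass_apply_of_ne _ hd.1 h]
        exact σ.bypass_ne hd.2.1
    rw [← hc₀ _ hn2 hn1]
    by_cases h' : α e = e
    · -- the bypassed darts coincide, and the second bypass changes nothing
      have h3 : σ.bypass e d ≠ e := σ.bypass_ne hd.2.1
      rw [h', Perm.bypass_apply_of_ne _ hd.2.1 h3]
      exact σ.bypass_potential (by simp [c₀]) he hf2 hd.2.2 hd.2.1
    · refine Perm.bypass_potential (S := S.erase e) _ (by simp [c₀]) ?_ ?_ ?_ hd.1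
      · simp [h', hrev e he]
      · intro d hd
        rw [Finset.mem_erase] at hd
        exact σ.bypass_potential (by simp [c₀]) he hf2 hd.2 hd.1
      · simp [hd.2]

open scoped Classical in
theorem delete (h : IsPlaneMap α S σ o) (hα : ∀ d, α (α d) = d) {e : D} (he : e ∈ S) :
    IsPlaneMap α ((S.erase e).erase (α e)) ((σ.bypass e).bypass (α e)) o := by
  refine bypass_edge hα h.rev_mem h.rot_mem h.sameCycle_iff he fun c hc _ _ hsum => ?_
  obtain ⟨f, hf⟩ := h.exists_potential c hc hsum
  exact ⟨f, fun d hd _ _ => (hf d hd).1, fun d hd => (hf d hd).2⟩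

open scoped Classical in
/-- Contracting an edge that is not a loop: the label of the end of `e` is replaced by that of its
origin. -/
theorem contract (h : IsPlaneMap α S σ o) (hα : ∀ d, α (α d) = d) {e : D} (he : e ∈ S)
    (hne : o (α e) ≠ o e) :
    IsPlaneMap α ((S.erase e).erase (α e)) (((σ * swap e (α e)).bypass e).bypass (α e))
      (fun d => if o d = o (α e) then o e else o d) := by
  have he' := h.rev_mem e he
  have hee : α e ≠ e := fun h' => hne (congrArg o h')
  have hstep : ∀ d ∈ S, o (σ d) = o d := fun d hd =>
    ((h.sameCycle_iff _ (h.rot_mem d hd) _ hd).1 (Perm.sameCycle_apply_left.2 (.refl _ _)))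
  have hsw : ∀ d ∈ S, swap e (α e) d ∈ S := by
    intro d hd
    rcases eq_or_ne d e with rfl | h1
    · rwa [swap_apply_left]
    rcases eq_or_ne d (α e) with rfl | h2
    · rwa [swap_apply_right]
    rwa [swap_apply_of_ne_of_ne h1 h2]
  have hrot : ∀ d ∈ S, (σ * swap e (α e)) d ∈ S := fun d hd => h.rot_mem _ (hsw d hd)
  refine bypass_edge hα h.rev_mem hrot ?_ he ?_
  · intro d hd d' hd'
    constructor
    · rintro ⟨i, rfl⟩
      -- labels are preserved by each step of the joined rotation
      have hlab : ∀ d ∈ S, (if o ((σ * swap e (α e)) d) = o (α e) then o e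
          else o ((σ * swap e (α e)) d)) = (if o d = o (α e) then o e else o d) := by
        intro d hd
        rw [Perm.mul_apply, hstep _ (hsw d hd)]
        rcases eq_or_ne d e with rfl | h1
        · rw [swap_apply_left, if_pos rfl, if_neg hne.symm]
        rcases eq_or_ne d (α e) with rfl | h2
        · rw [swap_apply_right, if_pos rfl, if_neg hne.symm]
        rw [swap_apply_of_ne_of_ne h1 h2]
      have hpow : ∀ (n : ℕ), ∀ d ∈ S, ((σ * swap e (α e)) ^ n) d ∈ S ∧
          (if o (((σ * swap e (α e)) ^ n) d) = o (α e) then o e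
          else o (((σ * swap e (α e)) ^ n) d)) = (if o d = o (α e) then o e else o d) := by
        intro n
        induction n with
        | zero => intro d hd; simp [hd]
        | succ n ih =>
          intro d hd
          rw [pow_succ', Perm.mul_apply]
          exact ⟨hrot _ (ih d hd).1, (hlab _ (ih d hd).1).trans (ih d hd).2⟩
      obtain ⟨n, rfl | rfl⟩ := i.eq_nat_or_neg
      · rw [zpow_natCast]
        exact (hpow n d hd).2.symm
      · have := (hpow n _ hd').2
        rw [← Perm.mul_apply, zpow_neg, zpow_natCast, mul_inv_cancel, Perm.one_apply] at this
        rwa [zpow_neg, zpow_natCast]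
    · intro hlab
      have hnc : ¬ σ.SameCycle e (α e) := fun h' => hne ((h.sameCycle_iff e he _ he').1 h').symm
      have hjoin := σ.sameCycle_mul_swap_self hnc he h.rot_mem
      have hsub : ∀ x y, σ.SameCycle x y → (σ * swap e (α e)).SameCycle x y := by
        intro x y
        refine Perm.SameCycle.of_step fun x => ?_
        rcases eq_or_ne x e with rfl | h1
        · exact hjoin.trans ⟨1, by simp⟩
        rcases eq_or_ne x (α e) with rfl | h2
        · exact hjoin.symm.trans ⟨1, by simp⟩
        exact ⟨1, by simp [swap_apply_of_ne_of_ne h1 h2]⟩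
      have hto : ∀ d ∈ S, o d = o (α e) → (σ * swap e (α e)).SameCycle d e := fun d hd hd' =>
        (hsub _ _ ((h.sameCycle_iff d hd _ he').2 hd')).trans hjoin.symm
      split_ifs at hlab with h1 h2 h2
      · exact (hto d hd h1).trans (hto d' hd' h2).symm
      · exact (hto d hd h1).trans (hsub _ _ ((h.sameCycle_iff _ he _ hd').2 hlab))
      · exact (hsub _ _ ((h.sameCycle_iff _ hd _ he).2 hlab)).trans (hto d' hd' h2).symm
      · exact hsub _ _ ((h.sameCycle_iff _ hd _ hd').2 hlab)
  · intro c hc hce hce' hsum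
    -- the flow through the contracted edge balances the two ends of the edge
    let t : ℚ := -∑ d ∈ S with o d = o e, c d
    let s : D → ℚ := fun d => (if d = e then t else 0) - (if d = α e then t else 0)
    have hse : s e = t := by simp [s, hee.symm]
    have hse' : s (α e) = -t := by simp [s, hee]
    have hs : ∀ d, d ≠ e → d ≠ α e → s d = 0 := by
      intro d h1 h2
      simp [s, h1, h2]
    obtain ⟨f, hf⟩ := h.exists_potential (fun d => c d + s d) (by
        intro d hd
        rcases eq_or_ne d e with rfl | h1
        · rw [hse, hse', hce, hce']; ring
        rcases eq_or_ne d (α e) with rfl | h2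
        · rw [hα, hse, hse', hce, hce']; ring
        rw [hs d h1 h2, hs (α d) (fun h' => h2 (by rw [← h', hα]))
          (fun h' => h1 (by rw [← hα d, h', hα])), hc d hd]
        ring) (by
        intro v
        have hsv : ∑ d ∈ S with o d = v, s d =
            (if o e = v then t else 0) - (if o (α e) = v then t else 0) := by
          simp only [s, Finset.sum_sub_distrib, Finset.sum_ite_eq', Finset.mem_filter, he, he',
            true_and]
        rw [Finset.sum_add_distrib, hsv]
        rcases eq_or_ne (o e) v with rfl | h1
        · rw [if_pos rfl, if_neg hne]
          simp [t]
        rcases eq_or_ne (o (α e)) v with rfl | h2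
        · rw [if_neg h1, if_pos rfl]
          have h3 := hsum (o e)
          have h4 : ∑ d ∈ S with (if o d = o (α e) then o e else o d) = o e, c d =
              (∑ d ∈ S with o d = o (α e), c d) + ∑ d ∈ S with o d = o e, c d := by
            rw [← Finset.sum_union, ← Finset.filter_or]
            · refine Finset.sum_congr (Finset.filter_congr fun d _ => ?_) fun _ _ => rfl
              split_ifs with h5 <;> simp [h5]
            · rw [Finset.disjoint_filter]
              intro d _ h5 h6
              exact hne (h5.symm.trans h6)
          rw [h4] at h3
          simp only [t]
          linarith
        · rw [if_neg h1, if_neg h2, sub_zero, add_zero, ← hsum v]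
          refine Finset.sum_congr (Finset.filter_congr fun d _ => ?_) fun _ _ => rfl
          split_ifs with h5
          · simp [h1, h5, h2]
          · rfl)
    refine ⟨fun d => f d - s d, fun d hd h1 h2 => ?_, fun d hd => ?_⟩
    · have := (hf d hd).1
      dsimp only at this ⊢
      rw [this, hs d h1 h2, hs (α d) (fun h' => h2 (by rw [← h', hα]))
          (fun h' => h1 (by rw [← hα d, h', hα]))]
      ring
    · have h3 := (hf _ (hsw d hd)).2
      dsimp only at h3 ⊢
      rw [Perm.mul_apply, h3]
      have h4 : f (swap e (α e) d) = f d - s d := by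
        rcases eq_or_ne d e with rfl | h1
        · have := (hf d hd).1
          rw [swap_apply_left, this, hce]
          ring
        rcases eq_or_ne d (α e) with rfl | h2
        · have := (hf _ hd).1
          rw [hα] at this
          rw [swap_apply_right, this, hce']
          ring
        rw [swap_apply_of_ne_of_ne h1 h2, hs d h1 h2, sub_zero]
      rw [h4]
      ring

open scoped Classical in
/-- Contracting a map onto a coarser labelling `β` of the vertices whose fibres are connected:
the edges inside the fibres disappear, and the other ones remain. -/
theorem contract_fibres (hα : ∀ d, α (α d) = d) {W : Type*} (β : D → W) (n : ℕ) :
    ∀ (S : Finset D) (σ : Perm D) (o : D → V), IsPlaneMap α S σ o →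
      (∀ d ∈ S, ∀ d' ∈ S, o d = o d' → β d = β d') →
      (∀ d ∈ S, ∀ d' ∈ S, β d = β d' → Relation.EqvGen
        (fun u v => ∃ e ∈ S, β (α e) = β e ∧ o e = u ∧ o (α e) = v) (o d) (o d')) →
      ({d ∈ S | β (α d) = β d}).card = n →
      ∃ σ' : Perm D, IsPlaneMap α ({d ∈ S | β (α d) ≠ β d}) σ' β := by
  induction n using Nat.strong_induction_on with
  | _ n ih =>
    intro S σ o h hβ hconn hn
    by_cases hex : ∃ e ∈ S, β (α e) = β e
    · obtain ⟨e, he, hint⟩ := hex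
      have hlt : ({d ∈ (S.erase e).erase (α e) | β (α d) = β d}).card < n := by
        rw [← hn]
        refine Finset.card_lt_card (Finset.ssubset_iff_of_subset ?_ |>.2 ⟨e, ?_, ?_⟩)
        · exact Finset.filter_subset_filter _
            ((Finset.erase_subset _ _).trans (Finset.erase_subset _ _))
        · simp [he, hint]
        · simp
      have hsame : ({d ∈ (S.erase e).erase (α e) | β (α d) ≠ β d}) =
          ({d ∈ S | β (α d) ≠ β d}) := by
        ext d
        simp only [Finset.mem_filter, Finset.mem_erase]
        constructor
        · rintro ⟨⟨_, _, h1⟩, h2⟩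
          exact ⟨h1, h2⟩
        · rintro ⟨h1, h2⟩
          refine ⟨⟨?_, ?_, h1⟩, h2⟩
          · rintro rfl
            rw [hα] at h2
            exact h2 hint.symm
          · rintro rfl
            exact h2 hint
      have hmem : ∀ d ∈ S, d ≠ e → d ≠ α e → d ∈ (S.erase e).erase (α e) := by
        intro d hd h1 h2
        simp [hd, h1, h2]
      have hsub : ∀ d ∈ (S.erase e).erase (α e), d ∈ S := fun d hd =>
        Finset.mem_of_mem_erase (Finset.mem_of_mem_erase hd)
      rw [← hsame]
      by_cases hloop : o (α e) = o e
      · refine ih _ hlt _ _ o (h.delete hα he) (fun d hd d' hd' => hβ d (hsub d hd) d' (hsub d' hd'))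
          ?_ rfl
        intro d hd d' hd' hdd
        have := hconn d (hsub d hd) d' (hsub d' hd') hdd
        generalize o d = x at this ⊢
        generalize o d' = y at this ⊢
        induction this with
        | rel x y hxy =>
          obtain ⟨a, ha, hab, rfl, rfl⟩ := hxy
          rcases eq_or_ne a e with rfl | h1
          · rw [hloop]; exact .refl _
          rcases eq_or_ne a (α e) with rfl | h2
          · rw [hα, hloop]; exact .refl _
          exact .rel _ _ ⟨a, hmem a ha h1 h2, hab, rfl, rfl⟩
        | refl x => exact .refl _
        | symm x y _ ih => exact .symm _ _ ih
        | trans x y z _ _ ih1 ih2 => exact .trans _ _ _ ih1 ih2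
      · have hm : ∀ d ∈ S, o d = o (α e) → β d = β e := fun d hd hd' =>
          (hβ d hd _ (h.rev_mem e he) hd').trans hint
        refine ih _ hlt _ _ _ (h.contract hα he hloop) ?_ ?_ rfl
        · intro d hd d' hd' hdd
          have hd := hsub d hd
          have hd' := hsub d' hd'
          split_ifs at hdd with h1 h2 h2
          · rw [hm d hd h1, hm d' hd' h2]
          · rw [hm d hd h1, hβ e he d' hd' hdd]
          · rw [hm d' hd' h2, hβ d hd e he hdd]
          · exact hβ d hd d' hd' hdd
        · intro d hd d' hd' hdd
          have := hconn d (hsub d hd) d' (hsub d' hd') hdd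
          generalize o d = x at this ⊢
          generalize o d' = y at this ⊢
          induction this with
          | rel x y hxy =>
            obtain ⟨a, ha, hab, rfl, rfl⟩ := hxy
            rcases eq_or_ne a e with rfl | h1
            · rw [if_neg (Ne.symm hloop), if_pos rfl]; exact .refl _
            rcases eq_or_ne a (α e) with rfl | h2
            · rw [hα, if_neg (Ne.symm hloop), if_pos rfl]; exact .refl _
            exact .rel _ _ ⟨a, hmem a ha h1 h2, hab, rfl, rfl⟩
          | refl x => exact .refl _
          | symm x y _ ih => exact .symm _ _ ih
          | trans x y z _ _ ih1 ih2 => exact .trans _ _ _ ih1 ih2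
    · push Not at hex
      have hS : ({d ∈ S | β (α d) ≠ β d}) = S := Finset.filter_true_of_mem hex
      have hiff : ∀ d ∈ S, ∀ d' ∈ S, o d = o d' ↔ β d = β d' := by
        refine fun d hd d' hd' => ⟨hβ d hd d' hd', fun hdd => ?_⟩
        have := hconn d hd d' hd' hdd
        generalize o d = x at this ⊢
        generalize o d' = y at this ⊢
        induction this with
        | rel x y hxy =>
          obtain ⟨a, ha, hab, -⟩ := hxy
          exact absurd hab (hex a ha)
        | refl x => rfl
        | symm x y _ ih => exact ih.symm
        | trans x y z _ _ ih1 ih2 => exact ih1.trans ih2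
      rw [hS]
      refine ⟨σ, h.rev_mem, h.rot_mem, fun d hd d' hd' =>
        (h.sameCycle_iff d hd d' hd').trans (hiff d hd d' hd'), fun c hc hsum => ?_⟩
      refine h.exists_potential c hc fun v => ?_
      by_cases hv : ∃ d ∈ S, o d = v
      · obtain ⟨d, hd, rfl⟩ := hv
        rw [← hsum (β d)]
        exact Finset.sum_congr (Finset.filter_congr fun d' hd' => hiff d' hd' d hd) fun _ _ => rfl
      · push Not at hv
        rw [Finset.filter_false_of_mem hv, Finset.sum_empty]

end IsPlaneMap

/-! ### The square lattice as a plane map -/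

/-- The unit steps of the lattice `ℤ × ℤ`, in counterclockwise order. -/
def latticeStep : Fin 4 → ℤ × ℤ := ![(1, 0), (0, 1), (-1, 0), (0, -1)]

/-- The reversal of the dart that leaves a lattice point in a given direction. -/
def latticeRev (d : (ℤ × ℤ) × Fin 4) : (ℤ × ℤ) × Fin 4 := (d.1 + latticeStep d.2, d.2 + 2)

theorem latticeStep_add_two (k : Fin 4) : latticeStep (k + 2) = -latticeStep k := by
  fin_cases k <;> rfl

theorem latticeRev_latticeRev (d : (ℤ × ℤ) × Fin 4) : latticeRev (latticeRev d) = d := by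
  obtain ⟨p, k⟩ := d
  have : k + 2 + 2 = k := by revert k; decide
  simp [latticeRev, latticeStep_add_two, this]

/-- The lower left corner of the unit square on the left of a dart. -/
def leftSquare (d : (ℤ × ℤ) × Fin 4) : ℤ × ℤ :=
  d.1 + (![(0, 0), (-1, 0), (-1, -1), (0, -1)] : Fin 4 → ℤ × ℤ) d.2

theorem leftSquare_latticeRev (p : ℤ × ℤ) (k : Fin 4) :
    leftSquare (latticeRev (p, k + 1)) = leftSquare (p, k) := by
  fin_cases k <;> ext <;> simp [leftSquare, latticeRev, latticeStep]

/-- Around a lattice point, a set of directions can be rotated counterclockwise: each direction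
is sent to the next one of the set. -/
theorem exists_rotation_directions (s : Finset (Fin 4)) : ∃ π : Perm (Fin 4), ∀ k ∈ s, π k ∈ s ∧
    (∀ k' ∈ s, ∃ i : Fin 4, (π ^ (i : ℕ)) k = k') ∧
    ∃ j : Fin 4, π k = k + j + 1 ∧ ∀ i < j, k + i + 1 ∉ s := by
  revert s
  decide +kernel

theorem sum_Ioc_sub_sum_Ioc {N : ℤ} {u : ℤ → ℚ} (hu : ∀ y ≤ N, u y = 0) (y : ℤ) :
    ∑ i ∈ Finset.Ioc N y, u i - ∑ i ∈ Finset.Ioc N (y - 1), u i = u y := by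
  rcases le_or_gt y N with h | h
  · rw [Finset.Ioc_eq_empty (by omega), Finset.Ioc_eq_empty (by omega), hu y h]
    simp
  · have : Finset.Ioc N y = insert y (Finset.Ioc N (y - 1)) := by
      ext i
      simp only [Finset.mem_Ioc, Finset.mem_insert]
      omega
    rw [this, Finset.sum_insert (by simp)]
    ring

/-- A finitely supported flow on the lattice is the coboundary of a function on the unit squares:
sum up the horizontal flow below a square. -/
theorem exists_lattice_potential {N : ℤ} {c : (ℤ × ℤ) × Fin 4 → ℚ}
    (hN : ∀ d, d.1.2 ≤ N → c d = 0) (hrev : ∀ d, c (latticeRev d) = -c d)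
    (hsum : ∀ p, ∑ k, c (p, k) = 0) :
    ∃ g : ℤ × ℤ → ℚ, ∀ d, g (leftSquare (latticeRev d)) = g (leftSquare d) - c d := by
  let g : ℤ × ℤ → ℚ := fun q => ∑ y ∈ Finset.Ioc N q.2, c ((q.1, y), 0)
  have hh : ∀ x y : ℤ, g (x, y) - g (x, y - 1) = c ((x, y), 0) := fun x y =>
    sum_Ioc_sub_sum_Ioc (u := fun y => c ((x, y), 0)) (fun y hy => hN _ hy) y
  have hleft : ∀ x y : ℤ, c ((x, y), 2) = -c ((x - 1, y), 0) := by
    intro x y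
    rw [← hrev]
    congr 1
    simp [latticeRev, latticeStep]
  have hdown : ∀ x y : ℤ, c ((x, y), 3) = -c ((x, y - 1), 1) := by
    intro x y
    rw [← hrev]
    congr 1
    simp [latticeRev, latticeStep]
  have hv0 : ∀ x y : ℤ, y ≤ N → g (x - 1, y) - g (x, y) = c ((x, y), 1) := by
    intro x y hy
    simp only [g]
    rw [Finset.Ioc_eq_empty (by omega), hN _ hy]
    simp
  have hv : ∀ x y : ℤ, g (x - 1, y) - g (x, y) = c ((x, y), 1) := by
    intro x y
    rcases le_total y N with hy | hy
    · exact hv0 x y hy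
    · induction y, hy using Int.leInduction with
      | base => exact hv0 x N le_rfl
      | succ y hy ih =>
        have h1 := hh (x - 1) (y + 1)
        have h2 := hh x (y + 1)
        have h3 := hsum (x, y + 1)
        rw [Fin.sum_univ_four, hleft, hdown] at h3
        simp only [add_sub_cancel_right] at h1 h2 h3
        linarith
  have h0 : ∀ p : ℤ × ℤ, g (leftSquare (latticeRev (p, 0))) = g (leftSquare (p, 0)) - c (p, 0) := by
    rintro ⟨x, y⟩
    have : latticeRev ((x, y), 0) = ((x + 1, y), 2) := by simp [latticeRev, latticeStep]
    rw [this, ← hh x y]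
    simp [leftSquare, ← sub_eq_add_neg]
  have h1 : ∀ p : ℤ × ℤ, g (leftSquare (latticeRev (p, 1))) = g (leftSquare (p, 1)) - c (p, 1) := by
    rintro ⟨x, y⟩
    have : latticeRev ((x, y), 1) = ((x, y + 1), 3) := by simp [latticeRev, latticeStep]
    rw [this, ← hv x y]
    simp [leftSquare, ← sub_eq_add_neg]
  -- the other two directions are the reversals of these
  have hback : ∀ d, g (leftSquare (latticeRev (latticeRev d))) =
      g (leftSquare (latticeRev d)) - c (latticeRev d) →
      g (leftSquare (latticeRev d)) = g (leftSquare d) - c d := by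
    intro d hd
    rw [latticeRev_latticeRev, hrev] at hd
    linarith
  refine ⟨g, ?_⟩
  rintro ⟨p, k⟩
  fin_cases k
  · exact h0 p
  · exact h1 p
  · exact hback _ (h0 _)
  · exact hback _ (h1 _)

open scoped Classical in
/-- A finite subgraph of the square lattice, with its rotation, is a plane map. -/
theorem exists_isPlaneMap_lattice (S : Finset ((ℤ × ℤ) × Fin 4))
    (hS : ∀ d ∈ S, latticeRev d ∈ S) :
    ∃ σ, IsPlaneMap latticeRev S σ Prod.fst := by
  choose π hπ using fun p : ℤ × ℤ => exists_rotation_directions {k | (p, k) ∈ S}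
  simp only [Finset.mem_filter, Finset.mem_univ, true_and] at hπ
  let σ : Perm ((ℤ × ℤ) × Fin 4) := Equiv.prodShear (Equiv.refl _) π
  have hσ : ∀ p k, σ (p, k) = (p, π p k) := fun _ _ => rfl
  have hpow : ∀ (i : ℕ) p k, (σ ^ i) (p, k) = (p, (π p ^ i) k) := by
    intro i p k
    induction i with
    | zero => rfl
    | succ i ih => rw [pow_succ', pow_succ', Perm.mul_apply, ih, hσ, Perm.mul_apply]
  refine ⟨σ, hS, ?_, ?_, ?_⟩
  · rintro ⟨p, k⟩ hd
    exact (hπ p k hd).1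
  · rintro ⟨p, k⟩ hd ⟨p', k'⟩ hd'
    constructor
    · rintro ⟨i, hi⟩
      obtain ⟨n, rfl | rfl⟩ := i.eq_nat_or_neg
      · rw [zpow_natCast, hpow] at hi
        exact (Prod.mk.inj hi).1
      · rw [zpow_neg, Perm.inv_eq_iff_eq, zpow_natCast, hpow] at hi
        exact (Prod.mk.inj hi).1
    · rintro (rfl : p = p')
      obtain ⟨i, hi⟩ := (hπ p k hd).2.1 k' hd'
      exact ⟨(i : ℕ), by rw [zpow_natCast, hpow, hi]⟩
  · intro c hc hsum
    obtain ⟨N, hN⟩ : ∃ N : ℤ, ∀ d ∈ S, N < d.1.2 := by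
      obtain ⟨N, hN⟩ := (S.image fun d => d.1.2).bddBelow
      refine ⟨N - 1, fun d hd => ?_⟩
      have : N ≤ d.1.2 := hN (Finset.mem_coe.2 (Finset.mem_image_of_mem _ hd))
      omega
    let c₀ : (ℤ × ℤ) × Fin 4 → ℚ := fun d => if d ∈ S then c d else 0
    have hc₀ : ∀ d ∈ S, c₀ d = c d := fun d hd => if_pos hd
    obtain ⟨g, hg⟩ := exists_lattice_potential (N := N) (c := c₀)
      (fun d hd => if_neg fun h => by have := hN d h; omega) (by
        intro d
        by_cases hd : d ∈ S
        · rw [hc₀ d hd, hc₀ _ (hS d hd), hc d hd]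
        · have : latticeRev d ∉ S := fun h => hd (latticeRev_latticeRev d ▸ hS _ h)
          simp [c₀, hd, this]) (by
        intro p
        rw [← hsum p]
        simp only [c₀]
        rw [← Finset.sum_filter]
        refine Finset.sum_bij (fun k _ => (p, k)) ?_ ?_ ?_ ?_
        · intro k hk
          simpa using hk
        · intro k _ k' _ h
          exact congrArg Prod.snd h
        · rintro ⟨p', k⟩ h
          simp only [Finset.mem_filter] at h
          obtain ⟨h, rfl⟩ := h
          exact ⟨k, by simpa using h, rfl⟩
        · intro _ _
          rfl)
    have hturn : ∀ p k, g (leftSquare (p, k + 1)) = g (leftSquare (p, k)) + c₀ (p, k + 1) := by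
      intro p k
      rw [← leftSquare_latticeRev p k, hg]
      ring
    refine ⟨fun d => g (leftSquare d), ?_⟩
    rintro ⟨p, k⟩ hd
    refine ⟨by rw [← hc₀ _ hd]; exact hg _, ?_⟩
    obtain ⟨hmem, -, j, hj, hskip⟩ := hπ p k hd
    rw [hσ, ← hc₀ _ hmem, hj]
    dsimp only
    -- no flow is crossed while turning over the directions outside `S`
    have hzero : ∀ i < j, c₀ (p, k + i + 1) = 0 := fun i hi => if_neg (hskip i hi)
    have h0 := hturn p k
    have h1 := hturn p (k + 1)
    have h2 := hturn p (k + 2)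
    have h3 := hturn p (k + 3)
    have e1 : ∀ k : Fin 4, k + 1 + 1 = k + 2 := by decide
    have e2 : ∀ k : Fin 4, k + 2 + 1 = k + 3 := by decide
    rw [e1] at h1
    rw [e2] at h2
    fin_cases j
    · simpa using h0
    · have z0 := hzero 0 (by decide)
      simp only [add_zero, Fin.mk_one] at z0 ⊢
      rw [e1]
      linarith
    · have z0 := hzero 0 (by decide)
      have z1 := hzero 1 (by decide)
      simp only [add_zero, Fin.reduceFinMk] at z0 z1 ⊢
      rw [e1] at z1
      rw [e2]
      linarith
    · have z0 := hzero 0 (by decide)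
      have z1 := hzero 1 (by decide)
      have z2 := hzero 2 (by decide)
      simp only [add_zero, Fin.reduceFinMk] at z0 z1 z2 ⊢
      rw [e1] at z1
      rw [e2] at z2
      linarith

/-! ### Discretization of plane sets -/

/-- Adjacency of lattice points inside a set `N`. -/
def LatticeAdjIn (N : Set (ℤ × ℤ)) (p q : ℤ × ℤ) : Prop :=
  p ∈ N ∧ q ∈ N ∧ ∃ k, q = p + latticeStep k

/-- Two lattice points are linked in `N` if a lattice walk inside `N` joins them. -/
abbrev LatticeLinked (N : Set (ℤ × ℤ)) : ℤ × ℤ → ℤ × ℤ → Prop :=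
  Relation.ReflTransGen (LatticeAdjIn N)

theorem LatticeAdjIn.symm {N : Set (ℤ × ℤ)} {p q : ℤ × ℤ} (h : LatticeAdjIn N p q) :
    LatticeAdjIn N q p := by
  obtain ⟨hp, hq, k, rfl⟩ := h
  exact ⟨hq, hp, k + 2, by simp [latticeStep_add_two]⟩

theorem LatticeLinked.symm {N : Set (ℤ × ℤ)} {p q : ℤ × ℤ} (h : LatticeLinked N p q) :
    LatticeLinked N q p := by
  induction h with
  | refl => exact .refl
  | tail _ hbc ih => exact .head hbc.symm ih

theorem LatticeLinked.mono {N N' : Set (ℤ × ℤ)} (hN : N ⊆ N') {p q : ℤ × ℤ}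
    (h : LatticeLinked N p q) : LatticeLinked N' p q :=
  Relation.ReflTransGen.mono (fun _ _ hab => ⟨hN hab.1, hN hab.2.1, hab.2.2⟩) _ _ h

/-- The lattice point below and to the left of a point, in the lattice of mesh `ε`. -/
noncomputable def latticeFloor (ε : ℝ) (z : Plane) : ℤ × ℤ := (⌊z 0 / ε⌋, ⌊z 1 / ε⌋)

/-- The discretization of a set `K` of the plane in the lattice of mesh `ε`: the union of the
three by three boxes around the lattice floors of the points of `K`. -/
def latticeCells (ε : ℝ) (K : Set Plane) : Set (ℤ × ℤ) :=
  {p | ∃ z ∈ K, |p.1 - (latticeFloor ε z).1| ≤ 1 ∧ |p.2 - (latticeFloor ε z).2| ≤ 1}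

theorem latticeFloor_mem_latticeCells {ε : ℝ} {K : Set Plane} {z : Plane} (hz : z ∈ K) :
    latticeFloor ε z ∈ latticeCells ε K :=
  ⟨z, hz, by simp, by simp⟩

theorem abs_sub_lt_of_abs_floor_sub_le {ε a b : ℝ} (hε : 0 < ε) {m : ℕ}
    (h : |⌊a / ε⌋ - ⌊b / ε⌋| ≤ m) : |a - b| < (m + 1) * ε := by
  have ha : a = a / ε * ε := by field_simp
  have hb : b = b / ε * ε := by field_simp
  have key : |a / ε - b / ε| < m + 1 := by
    have h' : (|⌊a / ε⌋ - ⌊b / ε⌋| : ℝ) ≤ m := by exact_mod_cast h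
    rw [abs_le] at h'
    rw [abs_lt]
    have := Int.floor_le (a / ε)
    have := Int.lt_floor_add_one (a / ε)
    have := Int.floor_le (b / ε)
    have := Int.lt_floor_add_one (b / ε)
    constructor <;> linarith [h'.1, h'.2]
  rw [ha, hb, ← sub_mul, abs_mul, abs_of_pos hε]
  exact mul_lt_mul_of_pos_right key hε

theorem abs_floor_sub_le_one {ε a b : ℝ} (hε : 0 < ε) (h : |a - b| < ε) :
    |⌊a / ε⌋ - ⌊b / ε⌋| ≤ 1 := by
  have key : |a / ε - b / ε| < 1 := by
    rw [← sub_div, abs_div, abs_of_pos hε, div_lt_one hε]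
    exact h
  rw [abs_lt] at key
  have h1 := Int.floor_le (a / ε)
  have h2 := Int.lt_floor_add_one (a / ε)
  have h3 := Int.floor_le (b / ε)
  have h4 := Int.lt_floor_add_one (b / ε)
  have h5 : (⌊a / ε⌋ : ℝ) < ⌊b / ε⌋ + 2 := by linarith
  have h6 : (⌊b / ε⌋ : ℝ) < ⌊a / ε⌋ + 2 := by linarith
  have h5' : ⌊a / ε⌋ < ⌊b / ε⌋ + 2 := by exact_mod_cast h5
  have h6' : ⌊b / ε⌋ < ⌊a / ε⌋ + 2 := by exact_mod_cast h6
  rw [abs_le]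
  omega

theorem abs_apply_sub_le_dist (z w : Plane) (i : Fin 2) : |z i - w i| ≤ dist z w := by
  rw [dist_eq_norm, ← Real.norm_eq_abs]
  exact PiLp.norm_apply_le (z - w) i

theorem dist_lt_of_abs_sub_lt {z w : Plane} {r : ℝ} (h0 : |z 0 - w 0| < r)
    (h1 : |z 1 - w 1| < r) : dist z w < 2 * r := by
  have hr : 0 < r := (abs_nonneg _).trans_lt h0
  have h := EuclideanSpace.dist_sq_eq z w
  rw [Fin.sum_univ_two, Real.dist_eq, Real.dist_eq] at h
  have h0' : |z 0 - w 0| ^ 2 < r ^ 2 := by gcongr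
  have h1' : |z 1 - w 1| ^ 2 < r ^ 2 := by gcongr
  refine lt_of_pow_lt_pow_left₀ 2 (by positivity) ?_
  rw [h]
  nlinarith

theorem finite_latticeCells {ε : ℝ} (hε : 0 < ε) {K : Set Plane} (hK : IsCompact K) :
    (latticeCells ε K).Finite := by
  obtain ⟨R, hR⟩ := hK.isBounded.subset_closedBall 0
  have hbound : ∀ z ∈ K, ∀ i, |z i / ε| ≤ R / ε := by
    intro z hz i
    rw [abs_div, abs_of_pos hε]
    gcongr
    have h1 := abs_apply_sub_le_dist z 0 i
    have h2 : dist z 0 ≤ R := hR hz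
    simp only [PiLp.zero_apply, sub_zero] at h1
    exact h1.trans h2
  obtain ⟨M, hM⟩ := exists_nat_gt (R / ε)
  have hfloor : ∀ z ∈ K, ∀ i, |⌊z i / ε⌋| ≤ M + 1 := by
    intro z hz i
    have h1 := abs_le.1 (hbound z hz i)
    have h2 := Int.floor_le (z i / ε)
    have h3 := Int.lt_floor_add_one (z i / ε)
    have h4 : (⌊z i / ε⌋ : ℝ) < M + 1 := by linarith
    have h5 : (-(M : ℝ) - 1) < ⌊z i / ε⌋ := by linarith
    have h4' : ⌊z i / ε⌋ < M + 1 := by exact_mod_cast h4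
    have h5' : (-(M : ℤ) - 1) < ⌊z i / ε⌋ := by exact_mod_cast h5
    rw [abs_le]
    omega
  refine ((Set.finite_Icc (-(M + 2 : ℤ)) (M + 2)).prod
    (Set.finite_Icc (-(M + 2 : ℤ)) (M + 2))).subset ?_
  rintro p ⟨z, hz, h1, h2⟩
  have h3 := hfloor z hz 0
  have h4 := hfloor z hz 1
  simp only [latticeFloor] at h1 h2
  rw [abs_le] at h1 h2 h3 h4
  simp only [Set.mem_prod, Set.mem_Icc]
  omega

/-- In a sufficiently fine lattice, disjoint members of a finite family of compact sets have
disjoint discretizations. -/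
theorem exists_mesh {ι : Type*} [Finite ι] (K : ι → Set Plane) (hK : ∀ i, IsCompact (K i)) :
    ∃ ε : ℝ, 0 < ε ∧ ∀ i j, Disjoint (K i) (K j) →
      Disjoint (latticeCells ε (K i)) (latticeCells ε (K j)) := by
  have key : ∀ i j, Disjoint (K i) (K j) → ∀ᶠ ε in nhdsWithin (0 : ℝ) (Set.Ioi 0),
      Disjoint (latticeCells ε (K i)) (latticeCells ε (K j)) := by
    intro i j hij
    obtain ⟨δ, hδ, h⟩ := hij.exists_thickenings (hK i) (hK j).isClosed
    filter_upwards [Ioo_mem_nhdsGT (show (0 : ℝ) < δ / 6 by positivity)] with ε hε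
    rw [Set.disjoint_left]
    rintro p ⟨z, hz, hz0, hz1⟩ ⟨w, hw, hw0, hw1⟩
    simp only [latticeFloor] at hz0 hz1 hw0 hw1
    rw [abs_le] at hz0 hz1 hw0 hw1
    have h0 := abs_sub_lt_of_abs_floor_sub_le (a := z 0) (b := w 0) hε.1 (m := 2)
      (by rw [abs_le]; push_cast; omega)
    have h1 := abs_sub_lt_of_abs_floor_sub_le (a := z 1) (b := w 1) hε.1 (m := 2)
      (by rw [abs_le]; push_cast; omega)
    have h2 := dist_lt_of_abs_sub_lt h0 h1
    push_cast at h2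
    refine Set.disjoint_left.1 h (Metric.mem_thickening_iff.2 ⟨z, hz, ?_⟩)
      (Metric.self_subset_thickening hδ _ hw)
    rw [dist_comm]
    linarith [hε.2]
  have hall : ∀ᶠ ε in nhdsWithin (0 : ℝ) (Set.Ioi 0), ∀ i j, Disjoint (K i) (K j) →
      Disjoint (latticeCells ε (K i)) (latticeCells ε (K j)) := by
    simp only [Filter.eventually_all]
    exact key
  obtain ⟨ε, h1, h2⟩ := (hall.and self_mem_nhdsWithin).exists
  exact ⟨ε, h2, h1⟩

/-- A point of a three by three box is linked with its centre, along the column of the point and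
then along the row of the centre. -/
theorem latticeLinked_box {N : Set (ℤ × ℤ)} {a : ℤ × ℤ}
    (hN : ∀ p : ℤ × ℤ, |p.1 - a.1| ≤ 1 → |p.2 - a.2| ≤ 1 → p ∈ N) {p : ℤ × ℤ}
    (h1 : |p.1 - a.1| ≤ 1) (h2 : |p.2 - a.2| ≤ 1) : LatticeLinked N p a := by
  obtain ⟨x, y⟩ := p
  obtain ⟨u, v⟩ := a
  simp only at h1 h2
  have hm : (x, v) ∈ N := hN _ h1 (by simp)
  have hp : (x, y) ∈ N := hN _ h1 h2
  have ha : (u, v) ∈ N := hN _ (by simp) (by simp)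
  have s1 : LatticeLinked N (x, y) (x, v) := by
    rw [abs_le] at h2
    obtain h | h | h : y = v ∨ y + 1 = v ∨ y - 1 = v := by omega
    · rw [h]
    · exact .single ⟨hp, hm, 1, by simp [latticeStep, h]⟩
    · exact .single ⟨hp, hm, 3, by simp [latticeStep, ← h, sub_eq_add_neg]⟩
  have s2 : LatticeLinked N (x, v) (u, v) := by
    rw [abs_le] at h1
    obtain h | h | h : x = u ∨ x + 1 = u ∨ x - 1 = u := by omega
    · rw [h]
    · exact .single ⟨hm, ha, 0, by simp [latticeStep, h]⟩
    · exact .single ⟨hm, ha, 2, by simp [latticeStep, ← h, sub_eq_add_neg]⟩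
  exact s1.trans s2

/-- The discretization of a connected set is connected. -/
theorem latticeLinked_latticeCells {ε : ℝ} (hε : 0 < ε) {K : Set Plane} (hK : IsPreconnected K)
    {p q : ℤ × ℤ} (hp : p ∈ latticeCells ε K) (hq : q ∈ latticeCells ε K) :
    LatticeLinked (latticeCells ε K) p q := by
  have hbox : ∀ z ∈ K, ∀ p : ℤ × ℤ, |p.1 - (latticeFloor ε z).1| ≤ 1 →
      |p.2 - (latticeFloor ε z).2| ≤ 1 → LatticeLinked (latticeCells ε K) p (latticeFloor ε z) :=
    fun z hz p h1 h2 => latticeLinked_box (N := latticeCells ε K)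
      (fun _ h1 h2 => ⟨z, hz, h1, h2⟩) h1 h2
  obtain ⟨z, hz, hz1, hz2⟩ := hp
  obtain ⟨w, hw, hw1, hw2⟩ := hq
  refine ((hbox z hz p hz1 hz2).trans ?_).trans (hbox w hw q hw1 hw2).symm
  refine hK.induction₂
    (fun z w => LatticeLinked (latticeCells ε K) (latticeFloor ε z) (latticeFloor ε w))
    ?_ (fun _ _ _ _ _ _ h1 h2 => h1.trans h2) (fun _ _ _ _ h => h.symm) hz hw
  intro z hz
  filter_upwards [mem_nhdsWithin_of_mem_nhds (Metric.ball_mem_nhds z hε)] with w hw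
  rw [Metric.mem_ball] at hw
  exact (hbox z hz (latticeFloor ε w)
    (abs_floor_sub_le_one hε ((abs_apply_sub_le_dist w z 0).trans_lt hw))
    (abs_floor_sub_le_one hε ((abs_apply_sub_le_dist w z 1).trans_lt hw))).symm

/-- If the vertices and the edges of a graph are represented by compact connected sets in the plane
that meet only where an edge meets its ends, then the graph is a minor of the square lattice: its
vertices are represented by disjoint finite connected sets of lattice points, and adjacent vertices
by sets that are joined by a lattice edge. -/
theorem exists_lattice_branch_sets {W : Type*} [Finite W] (H : SimpleGraph W)
    (X : W → Set Plane) (Y : H.Dart → Set Plane) (hY : ∀ d, Y d.symm = Y d)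
    (hXc : ∀ x, IsCompact (X x)) (hYc : ∀ d, IsCompact (Y d))
    (hXp : ∀ x, IsPreconnected (X x)) (hYp : ∀ d, IsPreconnected (Y d))
    (hXX : ∀ x y, x ≠ y → Disjoint (X x) (X y))
    (hYY : ∀ d d', d.edge ≠ d'.edge → Disjoint (Y d) (Y d'))
    (hXY : ∀ x d, x ≠ d.fst → x ≠ d.snd → Disjoint (X x) (Y d))
    (hmeet : ∀ d, (X d.fst ∩ Y d).Nonempty) :
    ∃ B : W → Set (ℤ × ℤ), (∀ x, (B x).Finite) ∧ (∀ x y, x ≠ y → Disjoint (B x) (B y)) ∧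
      (∀ x, ∀ p ∈ B x, ∀ q ∈ B x, LatticeLinked (B x) p q) ∧
      ∀ d : H.Dart, ∃ p ∈ B d.fst, ∃ k, p + latticeStep k ∈ B d.snd := by
  have : Finite H.Dart := Finite.of_injective _ SimpleGraph.Dart.toProd_injective
  obtain ⟨r, hr⟩ := exists_injective_nat W
  obtain ⟨ε, hε, hdisj⟩ := exists_mesh (Sum.elim X Y) (by rintro (x | d); exacts [hXc x, hYc d])
  let X' : W → Set (ℤ × ℤ) := fun x => latticeCells ε (X x)
  let Y' : H.Dart → Set (ℤ × ℤ) := fun d => latticeCells ε (Y d)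
  have hXX' : ∀ x y, x ≠ y → Disjoint (X' x) (X' y) := fun x y h =>
    hdisj (.inl x) (.inl y) (hXX x y h)
  have hYY' : ∀ d d', d.edge ≠ d'.edge → Disjoint (Y' d) (Y' d') := fun d d' h =>
    hdisj (.inr d) (.inr d') (hYY d d' h)
  have hXY' : ∀ x d, x ≠ d.fst → x ≠ d.snd → Disjoint (X' x) (Y' d) := fun x d h h' =>
    hdisj (.inl x) (.inr d) (hXY x d h h')
  -- an edge is absorbed by its end of smaller rank, up to where it reaches its other end
  let U : H.Dart → Set (ℤ × ℤ) := fun d =>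
    {p | ∃ p₀ ∈ X' d.fst, p₀ ∈ Y' d \ X' d.snd ∧ LatticeLinked (Y' d \ X' d.snd) p₀ p}
  have hUsub : ∀ d, U d ⊆ Y' d \ X' d.snd := by
    rintro d p ⟨p₀, -, hp₀, h⟩
    induction h with
    | refl => exact hp₀
    | tail _ hbc _ => exact hbc.2.1
  let B : W → Set (ℤ × ℤ) := fun x =>
    X' x ∪ ⋃ d ∈ {d : H.Dart | d.fst = x ∧ r d.fst < r d.snd}, U d
  have hXB : ∀ x, X' x ⊆ B x := fun x => Set.subset_union_left
  have hUB : ∀ d : H.Dart, r d.fst < r d.snd → U d ⊆ B d.fst := fun d hd =>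
    (Set.subset_biUnion_of_mem (u := U)
      (show d ∈ {d' : H.Dart | d'.fst = d.fst ∧ r d'.fst < r d'.snd} from ⟨rfl, hd⟩)).trans
      Set.subset_union_right
  have hBcases : ∀ x, ∀ p ∈ B x, p ∈ X' x ∨ ∃ d : H.Dart, d.fst = x ∧ r d.fst < r d.snd ∧ p ∈ U d := by
    rintro x p (hp | hp)
    · exact Or.inl hp
    · simp only [Set.mem_iUnion] at hp
      obtain ⟨d, hd, hp⟩ := hp
      exact Or.inr ⟨d, hd.1, hd.2, hp⟩
  refine ⟨B, fun x => ?_, fun x y hxy => ?_, fun x => ?_, fun d => ?_⟩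
  · refine (finite_latticeCells hε (hXc x)).union ?_
    exact (Set.toFinite _).biUnion fun d _ =>
      (finite_latticeCells hε (hYc d)).subset ((hUsub d).trans Set.sdiff_subset)
  · have hXU : ∀ x, ∀ d : H.Dart, x ≠ d.fst → ∀ p ∈ X' x, p ∉ U d := by
      intro x d hx p hp hU
      have hpU := hUsub d hU
      by_cases hx' : x = d.snd
      · exact hpU.2 (hx' ▸ hp)
      · exact Set.disjoint_left.1 (hXY' x d hx hx') hp hpU.1
    rw [Set.disjoint_left]
    intro p hpx hpy
    rcases hBcases x p hpx with h1 | ⟨d, rfl, hd, h1⟩ <;>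
      rcases hBcases y p hpy with h2 | ⟨d', rfl, hd', h2⟩
    · exact Set.disjoint_left.1 (hXX' x y hxy) h1 h2
    · exact hXU x d' hxy p h1 h2
    · exact hXU y d hxy.symm p h2 h1
    · refine Set.disjoint_left.1 (hYY' d d' fun he => ?_) (hUsub d h1).1 (hUsub d' h2).1
      rcases (SimpleGraph.dart_edge_eq_iff d d').1 he with rfl | rfl
      · exact hxy rfl
      · simp only [SimpleGraph.Dart.symm, Prod.fst_swap, Prod.snd_swap] at hd
        omega
  · have hto : ∀ p ∈ B x, ∃ q ∈ X' x, LatticeLinked (B x) q p := by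
      intro p hp
      rcases hBcases x p hp with h | ⟨d, rfl, hd, p₀, hp₀, hp₀', hlink⟩
      · exact ⟨p, h, .refl⟩
      · refine ⟨p₀, hp₀, ?_⟩
        have : LatticeLinked (U d) p₀ p := by
          induction hlink with
          | refl => exact .refl
          | tail hab hbc ih =>
            exact (ih (hUB d hd ⟨p₀, hp₀, hp₀', hab⟩)).tail
              ⟨⟨p₀, hp₀, hp₀', hab⟩, ⟨p₀, hp₀, hp₀', hab.tail hbc⟩, hbc.2.2⟩
        exact this.mono (hUB d hd)
    intro p hp q hq
    obtain ⟨p', hp', hpp'⟩ := hto p hp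
    obtain ⟨q', hq', hqq'⟩ := hto q hq
    exact (hpp'.symm.trans ((latticeLinked_latticeCells hε (hXp x) hp' hq').mono (hXB x))).trans
      hqq'
  · have key : ∀ d : H.Dart, r d.fst < r d.snd →
        ∃ p ∈ B d.fst, ∃ k, p + latticeStep k ∈ B d.snd := by
      intro d hd
      obtain ⟨z, hz⟩ := hmeet d
      obtain ⟨w, hw⟩ := hmeet d.symm
      rw [hY] at hw
      have hp : latticeFloor ε z ∈ X' d.fst := latticeFloor_mem_latticeCells hz.1
      have hp' : latticeFloor ε z ∈ Y' d := latticeFloor_mem_latticeCells hz.2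
      have hq : latticeFloor ε w ∈ X' d.snd := latticeFloor_mem_latticeCells hw.1
      have hq' : latticeFloor ε w ∈ Y' d := latticeFloor_mem_latticeCells hw.2
      have hp'' : latticeFloor ε z ∉ X' d.snd :=
        Set.disjoint_left.1 (hXX' _ _ d.fst_ne_snd) hp
      have hlink := latticeLinked_latticeCells hε (hYp d) hp' hq'
      have hstep : ∀ q, LatticeLinked (Y' d) (latticeFloor ε z) q → q ∈ U d ∨
          ∃ p ∈ U d, ∃ k, p + latticeStep k ∈ X' d.snd := by
        intro q h
        induction h with
        | refl => exact Or.inl ⟨_, hp, ⟨hp', hp''⟩, .refl⟩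
        | @tail b c _ hbc ih =>
          refine ih.elim (fun hb => ?_) Or.inr
          by_cases hc : c ∈ X' d.snd
          · obtain ⟨-, -, k, rfl⟩ := hbc
            exact Or.inr ⟨b, hb, k, hc⟩
          · have hb' := hUsub d hb
            obtain ⟨p₀, h1, h2, h3⟩ := hb
            exact Or.inl ⟨p₀, h1, h2, h3.tail ⟨hb', ⟨hbc.2.1, hc⟩, hbc.2.2⟩⟩
      rcases hstep _ hlink with h | ⟨p, hp, k, hk⟩
      · exact absurd hq (hUsub d h).2
      · exact ⟨p, hUB d hd hp, k, hXB _ hk⟩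
    rcases lt_or_gt_of_ne (hr.ne d.fst_ne_snd) with hd | hd
    · exact key d hd
    · obtain ⟨p, hp, k, hk⟩ := key d.symm hd
      exact ⟨_, hk, k + 2, by simpa [latticeStep_add_two] using hp⟩

/-! ### The rotation system of a plane drawing -/

/-- A choice for each dart of a graph, made on one of the two darts of each edge and carried over to
the other one by an involution `i`. -/
theorem SimpleGraph.exists_symm_choice {W A : Type*} [Countable W] {H : SimpleGraph W} {i : A → A}
    (hi : ∀ a, i (i a) = a) {P : H.Dart → A → Prop} (hP : ∀ d a, P d a → P d.symm (i a))
    (h : ∀ d, ∃ a, P d a) : ∃ f : H.Dart → A, ∀ d, P d (f d) ∧ f d.symm = i (f d) := by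
  obtain ⟨r, hr⟩ := exists_injective_nat W
  choose f hf using h
  refine ⟨fun d => if r d.fst < r d.snd then f d else i (f d.symm), fun d => ?_⟩
  have hd := hr.ne d.fst_ne_snd
  by_cases hlt : r d.fst < r d.snd
  · have hlt' : ¬ r d.symm.fst < r d.symm.snd := not_lt.2 hlt.le
    simp only [if_pos hlt, if_neg hlt', SimpleGraph.Dart.symm_symm]
    exact ⟨hf d, trivial⟩
  · have hlt' : r d.symm.fst < r d.symm.snd :=
      lt_of_le_of_ne (not_lt.1 hlt) hd.symm
    simp only [if_neg hlt, if_pos hlt', hi, and_true]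
    simpa using hP _ _ (hf d.symm)

/-- A finite graph drawn in the plane is a minor of the square lattice. -/
theorem IsPlanar.exists_lattice_branch_sets {W : Type*} [Finite W] {H : SimpleGraph W}
    (hH : IsPlanar H) :
    ∃ B : W → Set (ℤ × ℤ), (∀ x, (B x).Finite) ∧ (∀ x y, x ≠ y → Disjoint (B x) (B y)) ∧
      (∀ x, ∀ p ∈ B x, ∀ q ∈ B x, LatticeLinked (B x) p q) ∧
      ∀ d : H.Dart, ∃ p ∈ B d.fst, ∃ k, p + latticeStep k ∈ B d.snd := by
  obtain ⟨Δ⟩ := hH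
  have : Finite H.Dart := Finite.of_injective _ SimpleGraph.Dart.toProd_injective
  obtain ⟨γ, hγ⟩ := SimpleGraph.exists_symm_choice (H := H)
    (i := fun (γ : unitInterval → Plane) t => γ (unitInterval.symm t))
    (P := fun d γ => Continuous γ ∧ Function.Injective γ ∧ γ 0 = Δ.point d.fst ∧
      γ 1 = Δ.point d.snd ∧ Set.range γ = Δ.arc d.edge) (by simp) (by
      rintro d γ ⟨h1, h2, h3, h4, h5⟩
      refine ⟨h1.comp unitInterval.continuous_symm, fun s t hst => ?_, by simpa using h4,
        by simpa using h3, ?_⟩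
      · exact unitInterval.symm_bijective.injective (h2 hst)
      · rw [SimpleGraph.Dart.edge_symm, ← h5]
        exact unitInterval.symm_bijective.surjective.range_comp γ) (by
      intro d
      obtain ⟨γ, h⟩ := Δ.isArcBetween d.fst d.snd d.adj
      exact ⟨γ, h⟩)
  have hcont : ∀ d, Continuous (γ d) := fun d => (hγ d).1.1
  have hinj : ∀ d, Function.Injective (γ d) := fun d => (hγ d).1.2.1
  have hfst : ∀ d, γ d 0 = Δ.point d.fst := fun d => (hγ d).1.2.2.1
  have hsnd : ∀ d, γ d 1 = Δ.point d.snd := fun d => (hγ d).1.2.2.2.1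
  have harc : ∀ d, Set.range (γ d) = Δ.arc d.edge := fun d => (hγ d).1.2.2.2.2
  have hsymm : ∀ d t, γ d.symm t = γ d (unitInterval.symm t) := fun d t =>
    congrFun (hγ d).2 t
  -- arcs of different edges meet at common ends only
  have hend : ∀ d d' s t, d.edge ≠ d'.edge → γ d s = γ d' t → ∃ w,
      (w = d.fst ∧ s = 0 ∨ w = d.snd ∧ s = 1) ∧ (w = d'.fst ∧ t = 0 ∨ w = d'.snd ∧ t = 1) := by
    intro d d' s t hne heq
    obtain ⟨w, hw, hw', hpt⟩ := Δ.common_end_of_mem_arcs _ d.edge_mem _ d'.edge_mem hne (γ d s)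
      (harc d ▸ Set.mem_range_self s) (heq ▸ harc d' ▸ Set.mem_range_self t)
    have hpar : ∀ (d : H.Dart) s, w ∈ d.edge → Δ.point w = γ d s →
        w = d.fst ∧ s = 0 ∨ w = d.snd ∧ s = 1 := by
      intro d s hw hpt
      rcases Sym2.mem_iff.1 hw with rfl | rfl
      · exact Or.inl ⟨rfl, hinj d (hpt.symm.trans (hfst d).symm)⟩
      · exact Or.inr ⟨rfl, hinj d (hpt.symm.trans (hsnd d).symm)⟩
    exact ⟨w, hpar d s hw hpt, hpar d' t hw' (hpt.trans heq)⟩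
  let a : unitInterval := ⟨1 / 3, by norm_num, by norm_num⟩
  let b : unitInterval := unitInterval.symm a
  have hb : (b : ℝ) = 2 / 3 := by
    simp only [b, a, unitInterval.coe_symm_eq]
    norm_num
  have ha0 : (0 : unitInterval) < a := by
    rw [← Subtype.coe_lt_coe]
    norm_num [a]
  have hab : a < b := by
    rw [← Subtype.coe_lt_coe, hb]
    norm_num [a]
  have hb1 : b < 1 := by
    rw [← Subtype.coe_lt_coe, hb]
    norm_num
  have ha1 : a < 1 := hab.trans hb1
  let J : H.Dart → Set Plane := fun d => γ d '' Set.Icc 0 a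
  have hJ : ∀ d d', d.fst ≠ d'.fst → Disjoint (J d) (J d') := by
    intro d d' hne
    rw [Set.disjoint_left]
    rintro _ ⟨s, hs, rfl⟩ ⟨t, ht, heq⟩
    by_cases he : d.edge = d'.edge
    · rcases (SimpleGraph.dart_edge_eq_iff d d').1 he with rfl | rfl
      · exact hne rfl
      · rw [hsymm] at heq
        have h1 := hinj _ heq
        have h2 : b ≤ unitInterval.symm s := unitInterval.symm_le_symm.2 hs.2
        exact absurd (hab.trans_le (h2.trans (h1 ▸ ht.2))) (lt_irrefl _)
    · obtain ⟨w, ⟨rfl, -⟩ | ⟨-, rfl⟩, ⟨h, -⟩ | ⟨-, rfl⟩⟩ := hend d d' s t he heq.symm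
      · exact hne h
      · exact absurd ht.2 (not_le.2 ha1)
      · exact absurd hs.2 (not_le.2 ha1)
      · exact absurd hs.2 (not_le.2 ha1)
  refine _root_.exists_lattice_branch_sets H
    (fun x => ⋃ d : {d : H.Dart // d.fst = x}, J d)
    (fun d => γ d '' Set.Icc a b) ?_ ?_ ?_ ?_ ?_ ?_ ?_ ?_ ?_
  · intro d
    have : (fun t => γ d.symm t) = γ d ∘ unitInterval.symm := funext (hsymm d)
    rw [show γ d.symm = γ d ∘ unitInterval.symm from this, Set.image_comp]
    congr 1
    ext t
    constructor
    · rintro ⟨s, hs, rfl⟩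
      refine ⟨?_, ?_⟩
      · rw [← unitInterval.symm_symm a]
        exact unitInterval.symm_le_symm.2 hs.2
      · exact unitInterval.symm_le_symm.2 hs.1
    · intro ht
      refine ⟨unitInterval.symm t, ⟨?_, ?_⟩, by simp⟩
      · rw [← unitInterval.symm_symm a]
        exact unitInterval.symm_le_symm.2 ht.2
      · exact unitInterval.symm_le_symm.2 ht.1
  · intro x
    exact isCompact_iUnion fun d => isCompact_Icc.image (hcont d)
  · intro d
    exact isCompact_Icc.image (hcont d)
  · intro x
    rcases isEmpty_or_nonempty {d : H.Dart // d.fst = x} with h | h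
    · rw [Set.iUnion_of_empty]
      exact isPreconnected_empty
    · refine isPreconnected_iUnion ⟨Δ.point x, Set.mem_iInter.2 ?_⟩ fun d =>
        isPreconnected_Icc.image _ (hcont d).continuousOn
      rintro ⟨d, rfl⟩
      exact ⟨0, ⟨le_rfl, ha0.le⟩, hfst d⟩
  · intro d
    exact isPreconnected_Icc.image _ (hcont d).continuousOn
  · intro x y hxy
    simp only [Set.disjoint_iUnion_left, Set.disjoint_iUnion_right]
    rintro ⟨d, rfl⟩ ⟨d', rfl⟩
    exact hJ d' d hxy
  · intro d d' hne
    rw [Set.disjoint_left]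
    rintro _ ⟨s, hs, rfl⟩ ⟨t, ht, heq⟩
    obtain ⟨w, ⟨-, rfl⟩ | ⟨-, rfl⟩, -⟩ := hend d d' s t hne heq.symm
    · exact absurd hs.1 (not_le.2 ha0)
    · exact absurd hs.2 (not_le.2 hb1)
  · intro x d h1 h2
    rw [Set.disjoint_iUnion_left]
    rintro ⟨d', rfl⟩
    rw [Set.disjoint_left]
    rintro _ ⟨s, hs, rfl⟩ ⟨t, ht, heq⟩
    have hne : d.edge ≠ d'.edge := by
      intro he
      rcases (SimpleGraph.dart_edge_eq_iff d d').1 he with rfl | rfl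
      · exact h1 rfl
      · exact h2 rfl
    obtain ⟨w, ⟨-, rfl⟩ | ⟨-, rfl⟩, -⟩ := hend d d' t s hne heq
    · exact absurd ht.1 (not_le.2 ha0)
    · exact absurd ht.2 (not_le.2 hb1)
  · intro d
    refine ⟨γ d a, Set.mem_iUnion.2 ⟨⟨d, rfl⟩, a, ⟨ha0.le, le_rfl⟩, rfl⟩, a, ⟨le_rfl, hab.le⟩, rfl⟩

open scoped Classical in
/-- A plane map can be transported along a bijection between the sets of darts. -/
theorem IsPlaneMap.comap {D V D' V' : Type*} [Fintype D'] {α : D → D} {S : Finset D} {σ : Perm D}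
    {o : D → V} (h : IsPlaneMap α S σ o) {α' : D' → D'} {o' : D' → V'} {ℓ : D' → D}
    (hℓ : Function.Injective ℓ) (hmem : ∀ d, d ∈ S ↔ ∃ d', ℓ d' = d)
    (hα : ∀ d, ℓ (α' d) = α (ℓ d)) (ho : ∀ d d', o (ℓ d) = o (ℓ d') ↔ o' d = o' d') :
    ∃ σ' : Perm D', IsPlaneMap α' Finset.univ σ' o' := by
  have hS : ∀ d, ℓ d ∈ S := fun d => (hmem _).2 ⟨d, rfl⟩
  choose g hg using fun d => (hmem _).1 (h.rot_mem _ (hS d))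
  have hginj : Function.Injective g := fun d d' hdd => by
    have := congrArg ℓ hdd
    rw [hg, hg] at this
    exact hℓ (σ.injective this)
  let τ : Perm D' := Equiv.ofBijective g (Finite.injective_iff_bijective.1 hginj)
  have hτ : ∀ d, ℓ (τ d) = σ (ℓ d) := hg
  have hpow : ∀ (n : ℕ) d, ℓ ((τ ^ n) d) = (σ ^ n) (ℓ d) := by
    intro n d
    induction n with
    | zero => rfl
    | succ n ih => rw [pow_succ', pow_succ', Perm.mul_apply, Perm.mul_apply, hτ, ih]
  have hcyc : ∀ d d', τ.SameCycle d d' ↔ σ.SameCycle (ℓ d) (ℓ d') := by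
    intro d d'
    constructor
    · rintro ⟨i, hi⟩
      obtain ⟨n, rfl | rfl⟩ := i.eq_nat_or_neg
      · exact ⟨n, by rw [zpow_natCast] at hi ⊢; rw [← hpow, hi]⟩
      · rw [zpow_neg, Perm.inv_eq_iff_eq, zpow_natCast] at hi
        exact Perm.SameCycle.symm ⟨n, by rw [zpow_natCast, ← hpow, hi]⟩
    · rintro ⟨i, hi⟩
      obtain ⟨n, rfl | rfl⟩ := i.eq_nat_or_neg
      · rw [zpow_natCast, ← hpow] at hi
        exact ⟨n, by rw [zpow_natCast, hℓ hi]⟩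
      · rw [zpow_neg, Perm.inv_eq_iff_eq, zpow_natCast, ← hpow] at hi
        exact Perm.SameCycle.symm ⟨n, by rw [zpow_natCast, ← hℓ hi]⟩
  refine ⟨τ, fun _ _ => Finset.mem_univ _, fun _ _ => Finset.mem_univ _, fun d _ d' _ => ?_,
    fun c hc hsum => ?_⟩
  · rw [hcyc, h.sameCycle_iff _ (hS d) _ (hS d'), ho]
  · have hext : ∀ d, Function.extend ℓ c 0 (ℓ d) = c d := fun d => hℓ.extend_apply _ _ _
    obtain ⟨f, hf⟩ := h.exists_potential (Function.extend ℓ c 0) (by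
        intro d hd
        obtain ⟨d, rfl⟩ := (hmem d).1 hd
        rw [← hα, hext, hext, hc d (Finset.mem_univ _)]) (by
        intro v
        by_cases hv : ∃ d, o (ℓ d) = v
        · obtain ⟨d, rfl⟩ := hv
          rw [← hsum (o' d)]
          symm
          refine Finset.sum_bij (fun d _ => ℓ d) ?_ ?_ ?_ ?_
          · intro d' hd'
            simp only [Finset.mem_filter, Finset.mem_univ, true_and] at hd' ⊢
            exact ⟨hS d', (ho _ _).2 hd'⟩
          · intro _ _ _ _ h'
            exact hℓ h'
          · intro e he
            simp only [Finset.mem_filter] at he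
            obtain ⟨d', rfl⟩ := (hmem e).1 he.1
            exact ⟨d', by simpa using (ho _ _).1 he.2, rfl⟩
          · intro d' _
            exact (hext d').symm
        · push Not at hv
          refine Finset.sum_eq_zero fun e he => ?_
          simp only [Finset.mem_filter] at he
          obtain ⟨d', rfl⟩ := (hmem e).1 he.1
          exact absurd he.2 (hv d'))
    refine ⟨fun d => f (ℓ d), fun d _ => ?_⟩
    have := hf _ (hS d)
    rwa [← hα, ← hτ, hext, hext] at this

/-- A finite graph drawn in the plane has a rotation system of genus zero. -/
theorem IsPlanar.exists_isPlaneMap {W : Type*} [Finite W] {H : SimpleGraph W} [Fintype H.Dart]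
    (hH : IsPlanar H) :
    ∃ σ : Perm H.Dart, IsPlaneMap SimpleGraph.Dart.symm Finset.univ σ (fun d => d.fst) := by
  classical
  obtain ⟨B, hfin, hdisj, hlink, hadj⟩ := hH.exists_lattice_branch_sets
  have hBuniq : ∀ {x y p}, p ∈ B x → p ∈ B y → x = y := by
    intro x y p hx hy
    by_contra hne
    exact Set.disjoint_left.1 (hdisj x y hne) hx hy
  -- a lattice edge for each edge of the graph
  obtain ⟨ℓ, hℓ⟩ := SimpleGraph.exists_symm_choice (H := H) (i := latticeRev)
    latticeRev_latticeRev (P := fun d e => e.1 ∈ B d.fst ∧ (latticeRev e).1 ∈ B d.snd)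
    (fun d e h => ⟨h.2, by rw [latticeRev_latticeRev]; exact h.1⟩) (fun d => by
      obtain ⟨p, hp, k, hk⟩ := hadj d
      exact ⟨(p, k), hp, hk⟩)
  have hℓinj : Function.Injective ℓ := by
    intro d d' h
    ext
    · exact hBuniq (hℓ d).1.1 (h ▸ (hℓ d').1.1)
    · exact hBuniq (hℓ d).1.2 (h ▸ (hℓ d').1.2)
  let I : Set ((ℤ × ℤ) × Fin 4) := {e | ∃ x, e.1 ∈ B x ∧ (latticeRev e).1 ∈ B x}
  have hI : I.Finite := by
    refine ((Set.finite_iUnion hfin).prod (Set.finite_univ (α := Fin 4))).subset ?_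
    rintro e ⟨x, hx, -⟩
    exact ⟨Set.mem_iUnion.2 ⟨x, hx⟩, Set.mem_univ _⟩
  let S : Finset ((ℤ × ℤ) × Fin 4) := hI.toFinset ∪ Finset.univ.image ℓ
  have hS : ∀ e, e ∈ S ↔ e ∈ I ∨ ∃ d, ℓ d = e := by
    intro e
    simp [S]
  obtain ⟨σ, hσ⟩ := exists_isPlaneMap_lattice S (by
    intro e he
    rw [hS] at he ⊢
    rcases he with ⟨x, h1, h2⟩ | ⟨d, rfl⟩
    · exact Or.inl ⟨x, h2, by rwa [latticeRev_latticeRev]⟩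
    · exact Or.inr ⟨d.symm, (hℓ d).2⟩)
  let β : ℤ × ℤ → Option W := fun p => if h : ∃ x, p ∈ B x then some h.choose else none
  have hβ : ∀ {p x}, p ∈ B x → β p = some x := by
    intro p x hp
    have h : ∃ x, p ∈ B x := ⟨x, hp⟩
    simp only [β, dif_pos h]
    rw [hBuniq h.choose_spec hp]
  have hSB : ∀ e ∈ S, ∃ x, e.1 ∈ B x := by
    intro e he
    rcases (hS e).1 he with ⟨x, h, -⟩ | ⟨d, rfl⟩
    · exact ⟨x, h⟩
    · exact ⟨_, (hℓ d).1.1⟩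
  obtain ⟨τ, hτ⟩ := IsPlaneMap.contract_fibres latticeRev_latticeRev (fun e => β e.1) _ S σ
    Prod.fst hσ (fun d _ d' _ h => congrArg β h) (by
      intro e he e' he' hee
      obtain ⟨x, hx⟩ := hSB e he
      obtain ⟨x', hx'⟩ := hSB e' he'
      rw [hβ hx, hβ hx', Option.some_inj] at hee
      subst hee
      have := hlink x _ hx _ hx'
      generalize e'.1 = q at this ⊢
      induction this with
      | refl => exact .refl _
      | @tail b c _ hbc ih =>
        refine .trans _ _ _ ih (.rel _ _ ?_)
        obtain ⟨hb, hc, k, rfl⟩ := hbc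
        exact ⟨(b, k), (hS _).2 (Or.inl ⟨x, hb, hc⟩), (hβ hc).trans (hβ hb).symm, rfl, rfl⟩) rfl
  refine hτ.comap hℓinj (fun e => ?_) (fun d => (hℓ d).2) (fun d d' => ?_)
  · simp only [Finset.mem_filter, hS]
    constructor
    · rintro ⟨⟨x, h1, h2⟩ | h, hne⟩
      · exact absurd ((hβ h2).trans (hβ h1).symm) hne
      · exact h
    · rintro ⟨d, rfl⟩
      refine ⟨Or.inr ⟨d, rfl⟩, ?_⟩
      rw [hβ (hℓ d).1.1, hβ (hℓ d).1.2, Ne, Option.some_inj]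
      exact d.snd_ne_fst
  · rw [hβ (hℓ d).1.1, hβ (hℓ d').1.1, Option.some_inj]

/-! ### Faces and Euler's inequality -/

/-- The permutation whose cycles are the faces of a map: turn to the next dart around the origin,
and reverse it.  It runs through the darts that have the face on their left, backwards. -/
def facePerm {D : Type*} {α : D → D} (hα : Function.Involutive α) (σ : Perm D) : Perm D :=
  hα.toPerm * σ

theorem facePerm_apply {D : Type*} {α : D → D} (hα : Function.Involutive α) (σ : Perm D) (d : D) :
    facePerm hα σ d = α (σ d) := rfl

/-- The faces of a map: the cycles of its face permutation. -/
abbrev MapFace {D : Type*} {α : D → D} (hα : Function.Involutive α) (σ : Perm D) : Type _ :=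
  Quotient (Perm.SameCycle.setoid (facePerm hα σ))

/-- Invariance under a permutation passes from one step to a whole cycle. -/
theorem Equiv.Perm.SameCycle.map_eq {D A : Type*} {τ : Perm D} {f : D → A}
    (h : ∀ d, f (τ d) = f d) {d d' : D} (hdd : τ.SameCycle d d') : f d = f d' := by
  have hpow : ∀ (n : ℕ) d, f ((τ ^ n) d) = f d := by
    intro n d
    induction n with
    | zero => rfl
    | succ n ih => rw [pow_succ', Perm.mul_apply, h, ih]
  obtain ⟨i, hi⟩ := hdd
  obtain ⟨n, rfl | rfl⟩ := i.eq_nat_or_neg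
  · rw [zpow_natCast] at hi
    rw [← hi, hpow]
  · rw [zpow_neg, Perm.inv_eq_iff_eq, zpow_natCast] at hi
    rw [hi, hpow]

open scoped Classical in
/-- Euler's inequality `E + 2 ≤ V + F`.  The edges are counted by the darts of an orientation `P`.
The flows form a space of dimension at least `E - (V - 1)`, and they are all coboundaries of
functions on the faces, which form a space of dimension `F` whose constants have coboundary zero. -/
theorem IsPlaneMap.euler {D V : Type*} [Fintype D] [Fintype V] [Nonempty D] {α : D → D}
    (hα : Function.Involutive α) {σ : Perm D} {o : D → V} (h : IsPlaneMap α Finset.univ σ o)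
    {P : D → Prop} (hP : ∀ d, P (α d) ↔ ¬ P d)
    [Fintype (MapFace hα σ)] :
    Fintype.card {d // P d} + 2 ≤ Fintype.card V + Fintype.card (MapFace hα σ) := by
  let face : D → MapFace hα σ := fun d => Quotient.mk _ d
  have : Nonempty V := ⟨o (Classical.arbitrary D)⟩
  let anti : ({d // P d} → ℚ) →ₗ[ℚ] (D → ℚ) :=
    { toFun := fun u d => if hd : P d then u ⟨d, hd⟩ else -u ⟨α d, (hP d).2 hd⟩
      map_add' := by
        intro u v
        ext d
        by_cases hd : P d
        · simp [hd]
        · simp [hd]; ring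
      map_smul' := by
        intro r u
        ext d
        by_cases hd : P d <;> simp [hd] }
  have hanti : ∀ u d, anti u (α d) = -anti u d := by
    intro u d
    by_cases hd : P d
    · have hd' : ¬ P (α d) := fun h' => (hP d).1 h' hd
      simp [anti, hd, hd', hα d]
    · have hd' : P (α d) := (hP d).2 hd
      simp [anti, hd, hd']
  let bd : (D → ℚ) →ₗ[ℚ] (V → ℚ) :=
    { toFun := fun c v => ∑ d with o d = v, c d
      map_add' := by
        intro c c'
        ext v
        simp [Finset.sum_add_distrib]
      map_smul' := by
        intro r c
        ext v
        simp [Finset.mul_sum] }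
  let tot : (V → ℚ) →ₗ[ℚ] ℚ := ∑ v, LinearMap.proj v
  have htot : ∀ g, tot g = ∑ v, g v := by
    intro g
    simp [tot, LinearMap.sum_apply]
  have hsurj : Function.Surjective tot := by
    intro r
    refine ⟨Pi.single (Classical.arbitrary V) r, ?_⟩
    rw [htot, Finset.sum_pi_single']
    simp
  have hrange : LinearMap.range (bd ∘ₗ anti) ≤ LinearMap.ker tot := by
    rintro _ ⟨u, rfl⟩
    rw [LinearMap.mem_ker, htot]
    have h1 : ∑ v, (bd ∘ₗ anti) u v = ∑ d, anti u d :=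
      Finset.sum_fiberwise Finset.univ o (anti u)
    have h2 : ∑ d, anti u (α d) = ∑ d, anti u d := Equiv.sum_comp hα.toPerm (anti u)
    simp only [hanti, Finset.sum_neg_distrib] at h2
    rw [h1]
    linarith
  have hd1 := Submodule.finrank_mono hrange
  have hd2 := LinearMap.finrank_range_add_finrank_ker tot
  have hd3 := LinearMap.finrank_range_add_finrank_ker (bd ∘ₗ anti)
  rw [LinearMap.range_eq_top.2 hsurj, finrank_top, Module.finrank_self,
    Module.finrank_fintype_fun_eq_card] at hd2
  rw [Module.finrank_fintype_fun_eq_card] at hd3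
  let cob : (MapFace hα σ → ℚ) →ₗ[ℚ] ({d // P d} → ℚ) :=
    { toFun := fun f d => f (face d) - f (face (α d))
      map_add' := by
        intro f g
        ext d
        simp only [Pi.add_apply]
        ring
      map_smul' := by
        intro r f
        ext d
        simp only [Pi.smul_apply, smul_eq_mul, RingHom.id_apply]
        ring }
  have hker : LinearMap.ker (bd ∘ₗ anti) ≤ LinearMap.range cob := by
    intro u hu
    rw [LinearMap.mem_ker] at hu
    obtain ⟨f, hf⟩ := h.exists_potential (anti u) (fun d _ => hanti u d) (fun v => congrFun hu v)
    have hinv : ∀ d, f (facePerm hα σ d) = f d := by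
      intro d
      rw [facePerm_apply, (hf (σ d) (Finset.mem_univ _)).1, (hf d (Finset.mem_univ _)).2]
      ring
    refine ⟨Quotient.lift f fun d d' hdd => Perm.SameCycle.map_eq hinv hdd, ?_⟩
    ext ⟨d, hd⟩
    change f d - f (α d) = u ⟨d, hd⟩
    rw [(hf d (Finset.mem_univ _)).1]
    simp [anti, hd]
  have hd4 := Submodule.finrank_mono hker
  have hd5 := LinearMap.finrank_range_add_finrank_ker cob
  rw [Module.finrank_fintype_fun_eq_card] at hd5
  have hd6 : 0 < Module.finrank ℚ (LinearMap.ker cob) := by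
    rw [Module.finrank_pos_iff_exists_ne_zero]
    refine ⟨⟨fun _ => 1, ?_⟩, ?_⟩
    · rw [LinearMap.mem_ker]
      ext d
      simp [cob]
    · intro h0
      have := congrFun (congrArg Subtype.val h0) (face (Classical.arbitrary D))
      simp at this
  omega

/-! ### Charges around a vertex -/

/-- A cycle `s` of a permutation is run through once by the powers below its length. -/
theorem Equiv.Perm.pow_card_cycle_and_sum {D : Type*} [Finite D] [DecidableEq D] {σ : Perm D}
    {d₀ : D} {s : Finset D} (hs : ∀ d, d ∈ s ↔ σ.SameCycle d₀ d) :
    (σ ^ s.card) d₀ = d₀ ∧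
      ∀ g : D → ℕ, ∑ d ∈ s, g d = ∑ i ∈ Finset.range s.card, g ((σ ^ i) d₀) := by
  set n := Function.minimalPeriod σ d₀ with hn
  have hinj : Set.InjOn (fun i => (σ ^ i) d₀) (Finset.range n) := by
    intro i hi j hj hij
    rw [Finset.coe_range] at hi hj
    simp only [← Perm.iterate_eq_pow] at hij
    exact Function.iterate_injOn_Iio_minimalPeriod hi hj hij
  have hnper : (σ ^ n) d₀ = d₀ := by
    rw [← Perm.iterate_eq_pow]
    exact Function.isPeriodicPt_minimalPeriod σ d₀
  have hpos : 0 < n := by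
    rw [hn, Function.minimalPeriod_pos_iff_mem_periodicPts]
    exact ⟨orderOf σ, orderOf_pos σ, by
      rw [Function.IsPeriodicPt, Function.IsFixedPt, Perm.iterate_eq_pow, pow_orderOf_eq_one]
      rfl⟩
  have himg : s = (Finset.range n).image fun i => (σ ^ i) d₀ := by
    ext d
    rw [hs, Finset.mem_image]
    constructor
    · intro h
      obtain ⟨i, -, hi⟩ := h.exists_pow_eq'
      refine ⟨i % n, Finset.mem_range.2 (Nat.mod_lt _ hpos), ?_⟩
      rw [← hi, ← Perm.iterate_eq_pow, ← Perm.iterate_eq_pow,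
        Function.iterate_mod_minimalPeriod_eq]
    · rintro ⟨i, -, rfl⟩
      exact ⟨i, by simp⟩
  have hcard : s.card = n := by
    rw [himg, Finset.card_image_of_injOn hinj, Finset.card_range]
  refine ⟨hcard ▸ hnper, fun g => ?_⟩
  rw [hcard]
  conv_lhs => rw [himg]
  exact Finset.sum_image hinj

/-- The charge that a vertex of colour `c` takes from a neighbour around which it lies between
vertices of colours `x` and `y`. -/
def cornerWeight (x c y : Fin 3) : ℕ :=
  if x = y ∧ x ≠ c then 2 else if x = c ∨ y = c then 1 else 0

theorem cornerWeight_le_two (x c y : Fin 3) : cornerWeight x c y ≤ 2 := by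
  revert x c y
  decide

/-- If all three colours occur around a vertex of degree `n`, then the charge taken from it is at
most `4 n - 12`. -/
theorem sum_cornerWeight_add_le {D : Type*} [Finite D] {σ : Perm D} {d₀ : D} {s : Finset D}
    (hs : ∀ d, d ∈ s ↔ σ.SameCycle d₀ d) {κ : D → Fin 3} (hκ : ∀ k, ∃ d ∈ s, κ d = k) :
    ∑ d ∈ s, cornerWeight (κ (σ⁻¹ d)) (κ d) (κ (σ d)) + 12 ≤ 4 * s.card := by
  classical
  obtain ⟨hper, hsum⟩ := Perm.pow_card_cycle_and_sum hs
  have h3 : 3 ≤ s.card := by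
    have h1 : (Finset.univ : Finset (Fin 3)) ⊆ s.image κ := by
      intro k _
      obtain ⟨d, hd, hk⟩ := hκ k
      exact Finset.mem_image.2 ⟨d, hd, hk⟩
    have h2 := (Finset.card_le_card h1).trans Finset.card_image_le
    simpa using h2
  rcases Nat.lt_or_ge s.card 6 with h6 | h6
  · rw [hsum]
    let a : ℕ → Fin 3 := fun i => κ ((σ ^ i) d₀)
    have hsucc : ∀ i, κ (σ ((σ ^ i) d₀)) = a (i + 1) := by
      intro i
      simp only [a]
      rw [pow_succ', Perm.mul_apply]
    have hpred : ∀ i, κ (σ⁻¹ ((σ ^ (i + 1)) d₀)) = a i := by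
      intro i
      simp only [a]
      rw [pow_succ', Perm.mul_apply, Perm.inv_def, Equiv.symm_apply_apply]
    have hzero : ∀ n, s.card = n + 1 → κ (σ⁻¹ ((σ ^ 0) d₀)) = a n := by
      intro n hn
      rw [← hpred, ← hn, hper, pow_zero, Perm.one_apply]
    have ha : ∀ i, κ ((σ ^ i) d₀) = a i := fun _ => rfl
    have hlast : a s.card = a 0 := by simp only [a]; rw [hper, pow_zero, Perm.one_apply]
    have hcol : ∀ k, ∃ i < s.card, a i = k := by
      intro k
      by_contra hne
      push Not at hne
      obtain ⟨d, hd, hk⟩ := hκ k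
      have hz := hsum (fun d => if κ d = k then 1 else 0)
      rw [Finset.sum_eq_zero (s := Finset.range s.card)] at hz
      · have := (Finset.sum_eq_zero_iff.1 hz) d hd
        simp [hk] at this
      · intro i hi
        simpa using hne i (Finset.mem_range.1 hi)
    obtain hn | hn | hn : s.card = 3 ∨ s.card = 4 ∨ s.card = 5 := by omega
    · have h0 := hzero 2 hn
      rw [hn] at hlast hcol ⊢
      simp only [Finset.sum_range_succ, Finset.sum_range_zero, hsucc, hpred, h0, ha, hlast]
      have hcol' : ∀ k, a 0 = k ∨ a 1 = k ∨ a 2 = k := by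
        intro k
        obtain ⟨i, hi, h⟩ := hcol k
        interval_cases i <;> simp [h]
      generalize a 0 = a₀, a 1 = a₁, a 2 = a₂ at hcol' ⊢
      revert a₀ a₁ a₂
      decide +kernel
    · have h0 := hzero 3 hn
      rw [hn] at hlast hcol ⊢
      simp only [Finset.sum_range_succ, Finset.sum_range_zero, hsucc, hpred, h0, ha, hlast]
      have hcol' : ∀ k, a 0 = k ∨ a 1 = k ∨ a 2 = k ∨ a 3 = k := by
        intro k
        obtain ⟨i, hi, h⟩ := hcol k
        interval_cases i <;> simp [h]
      generalize a 0 = a₀, a 1 = a₁, a 2 = a₂, a 3 = a₃ at hcol' ⊢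
      revert a₀ a₁ a₂ a₃
      decide +kernel
    · -- Here the colours need not all occur: only for a constant sequence, where the weights are
      -- one, does each of the five points lie between points of equal colours.
      have h0 := hzero 4 hn
      rw [hn] at hlast ⊢
      simp only [Finset.sum_range_succ, Finset.sum_range_zero, hsucc, hpred, h0, ha, hlast]
      generalize a 0 = a₀, a 1 = a₁, a 2 = a₂, a 3 = a₃, a 4 = a₄
      revert a₀ a₁ a₂ a₃ a₄
      decide +kernel
  · have := Finset.sum_le_card_nsmul s
      (fun d => cornerWeight (κ (σ⁻¹ d)) (κ d) (κ (σ d))) 2 fun d _ => cornerWeight_le_two _ _ _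
    simp only [smul_eq_mul] at this
    omega

/-- A vertex of degree five all of whose faces are quadrangles obtains at least two units: if no
opposite vertex shares its colour `c`, then by parity two consecutive ones have equal colours. -/
theorem two_le_sum_cornerWeight (c x₀ x₁ x₂ x₃ x₄ : Fin 3) :
    2 ≤ cornerWeight x₀ c x₄ + cornerWeight x₁ c x₀ + cornerWeight x₂ c x₁ +
      cornerWeight x₃ c x₂ + cornerWeight x₄ c x₃ := by
  revert c x₀ x₁ x₂ x₃ x₄
  decide +kernel

/-! ### Counting faces and darts -/

open scoped Classical in
/-- Faces of a bipartite map without digons have length at least four.  If each dart leaving one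
side gives three units to its face when this is a quadrangle, and two units otherwise, then each
face obtains at least six units. -/
theorem six_mul_card_mapFace_le {D : Type*} [Fintype D] {α : D → D} (hα : Function.Involutive α)
    {σ : Perm D} [Fintype (MapFace hα σ)] {P : D → Prop}
    (hP : ∀ d, P (facePerm hα σ d) ↔ ¬ P d)
    (hdigon : ∀ d, facePerm hα σ (facePerm hα σ d) ≠ d) :
    6 * Fintype.card (MapFace hα σ) ≤
      ∑ d with P d, if (facePerm hα σ ^ 4) d = d then 3 else 2 := by
  set ψ := facePerm hα σ with hψ
  have h4 : ∀ d, (ψ ^ 4) d = ψ (ψ (ψ (ψ d))) := fun d => rfl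
  have key : ∀ q : MapFace hα σ,
      6 ≤ ∑ d ∈ {d | P d} with (Quotient.mk _ d : MapFace hα σ) = q,
        if (ψ ^ 4) d = d then 3 else 2 := by
    intro q
    obtain ⟨d, hd, rfl⟩ : ∃ d, P d ∧ (Quotient.mk _ d : MapFace hα σ) = q := by
      induction q using Quotient.inductionOn with
      | h d =>
        by_cases hd : P d
        · exact ⟨d, hd, rfl⟩
        · exact ⟨ψ d, (hP d).2 hd, Quotient.sound (Perm.sameCycle_apply_left.2 (.refl _ _))⟩
    have hmem : ∀ e, P e → ψ.SameCycle e d →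
        e ∈ ({e ∈ {e | P e} | (Quotient.mk _ e : MapFace hα σ) = Quotient.mk _ d} : Finset D) :=
      fun e he hed => by
        rw [Finset.mem_filter, Finset.mem_filter]
        exact ⟨⟨Finset.mem_univ _, he⟩, Quotient.sound hed⟩
    have hP2 : ∀ e, P e → P (ψ (ψ e)) := fun e he =>
      (hP _).2 fun h' => (hP e).1 h' he
    have hc2 : ∀ e, ψ.SameCycle e d → ψ.SameCycle (ψ (ψ e)) d := fun e he =>
      Perm.sameCycle_apply_left.2 (Perm.sameCycle_apply_left.2 he)
    have m0 := hmem d hd (.refl _ _)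
    have m2 := hmem _ (hP2 d hd) (hc2 d (.refl _ _))
    have m4 := hmem _ (hP2 _ (hP2 d hd)) (hc2 _ (hc2 d (.refl _ _)))
    by_cases hq : (ψ ^ 4) d = d
    · refine le_trans ?_ (Finset.sum_le_sum_of_subset (s := {d, ψ (ψ d)}) ?_)
      · rw [Finset.sum_pair (hdigon d).symm, if_pos hq, if_pos]
        rw [h4] at hq ⊢
        rw [hq]
      · intro e he
        rcases Finset.mem_insert.1 he with rfl | he
        · exact m0
        · rwa [Finset.mem_singleton.1 he]
    · refine le_trans ?_ (Finset.sum_le_sum_of_subset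
        (s := {d, ψ (ψ d), ψ (ψ (ψ (ψ d)))}) ?_)
      · rw [h4] at hq
        have hcard : ({d, ψ (ψ d), ψ (ψ (ψ (ψ d)))} : Finset D).card = 3 :=
          Finset.card_eq_three.2 ⟨_, _, _, (hdigon d).symm, Ne.symm hq,
            (hdigon (ψ (ψ d))).symm, rfl⟩
        calc 6 = ({d, ψ (ψ d), ψ (ψ (ψ (ψ d)))} : Finset D).card • 2 := by rw [hcard]; rfl
          _ ≤ _ := Finset.card_nsmul_le_sum _ _ _ fun e _ => by split_ifs <;> omega
      · intro e he
        simp only [Finset.mem_insert, Finset.mem_singleton] at he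
        rcases he with rfl | rfl | rfl
        · exact m0
        · exact m2
        · exact m4
  rw [← Finset.sum_fiberwise (g := fun d => (Quotient.mk _ d : MapFace hα σ))]
  calc 6 * Fintype.card (MapFace hα σ) = ∑ _q : MapFace hα σ, 6 := by
        rw [Finset.sum_const, Finset.card_univ, smul_eq_mul, mul_comm]
    _ ≤ _ := Finset.sum_le_sum fun q _ => key q

/-- A vertex of degree five all of whose faces are quadrangles obtains at least two units from its
neighbours, where `κ d` is the colour of the end of the dart `d`. -/
theorem two_le_sum_cornerWeight_of_quadrangles {D : Type*} [Finite D] [DecidableEq D] {α : D → D}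
    (hα : Function.Involutive α) {σ : Perm D} {κ : D → Fin 3}
    (hκ : ∀ d d', σ.SameCycle d d' → κ (α d) = κ (α d')) {d₀ : D} {s : Finset D}
    (hs : ∀ d, d ∈ s ↔ σ.SameCycle d₀ d) (hcard : s.card = 5)
    (hquad : ∀ d ∈ s, (facePerm hα σ ^ 4) d = d) :
    2 ≤ ∑ d ∈ s, cornerWeight (κ (σ⁻¹ (α d))) (κ (α d)) (κ (σ (α d))) := by
  -- the neighbours of `d` and of `σ d` on a common quadrangle see the same opposite vertex
  have hopp : ∀ d ∈ s, κ (σ (α (σ d))) = κ (σ⁻¹ (α d)) := by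
    intro d hd
    have hd' : α (σ (α (σ (α (σ (α (σ d))))))) = d := hquad d hd
    have h3 : α (σ (α (σ (α (σ d))))) = σ⁻¹ (α d) := by
      rw [Perm.eq_inv_iff_eq, ← hα (σ _), hd']
    rw [← h3, ← hα (σ (α (σ d)))]
    exact hκ _ _ (Perm.sameCycle_apply_right.2 (by rw [hα]))
  have hmem : ∀ i : ℕ, (σ ^ i) d₀ ∈ s := fun i => (hs _).2 ⟨i, by simp⟩
  obtain ⟨hper, hsum⟩ := Perm.pow_card_cycle_and_sum hs
  rw [hsum fun d => cornerWeight (κ (σ⁻¹ (α d))) (κ (α d)) (κ (σ (α d))), hcard]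
  rw [hcard] at hper
  let X : ℕ → Fin 3 := fun i => κ (σ⁻¹ (α ((σ ^ i) d₀)))
  have hX : ∀ i, κ (σ⁻¹ (α ((σ ^ i) d₀))) = X i := fun _ => rfl
  have hcol : ∀ i, κ (α ((σ ^ i) d₀)) = κ (α d₀) := fun i =>
    (hκ _ _ ((hs _).1 (hmem i))).symm
  have hnext : ∀ i, κ (σ (α ((σ ^ (i + 1)) d₀))) = X i := by
    intro i
    rw [pow_succ', Perm.mul_apply]
    exact hopp _ (hmem i)
  have hfirst : κ (σ (α ((σ ^ 0) d₀))) = X 4 := by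
    rw [← hnext, hper, pow_zero, Perm.one_apply]
  simp only [Finset.sum_range_succ, Finset.sum_range_zero, zero_add, hfirst, hcol, hX]
  have h1 := hnext 0
  have h2 := hnext 1
  have h3 := hnext 2
  have h4 := hnext 3
  simp only [zero_add, Nat.reduceAdd] at h1 h2 h3 h4
  rw [h1, h2, h3, h4]
  exact two_le_sum_cornerWeight _ _ _ _ _ _

open scoped Classical in
theorem SimpleGraph.sum_filter_sum_darts {W : Type*} [Fintype W] {H : SimpleGraph W}
    [Fintype H.Dart] (A : W → Prop) (g : H.Dart → ℕ) :
    ∑ x with A x, ∑ d : H.Dart with d.fst = x, g d = ∑ d with A d.fst, g d := by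
  rw [← Finset.sum_fiberwise_of_maps_to (s := ({d | A d.fst} : Finset H.Dart))
    (t := ({x | A x} : Finset W)) (g := fun d => d.fst) (by simp)]
  refine Finset.sum_congr rfl fun x hx => Finset.sum_congr ?_ fun _ _ => rfl
  ext d
  simp only [Finset.mem_filter, Finset.mem_univ, true_and] at hx ⊢
  exact ⟨fun h => ⟨h ▸ hx, h⟩, fun h => h.2⟩

/-! ### Emulators of the complete bipartite graph -/

theorem theorem8 :
    ¬ HasPlanarEmulator.{u} (completeBipartiteGraph (Fin 3) (Fin 5)) := by
  classical
  rintro ⟨W, hfin, H, φ, hplanar, hsurj, hloc⟩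
  have := Fintype.ofFinite W
  have := Fintype.ofFinite H.Dart
  obtain ⟨σ, hσ⟩ := hplanar.exists_isPlaneMap
  have hα : Function.Involutive (SimpleGraph.Dart.symm : H.Dart → H.Dart) :=
    SimpleGraph.Dart.symm_involutive
  let ψ : Perm H.Dart := facePerm hα σ
  have hψ : ∀ d, ψ d = (σ d).symm := fun _ => rfl
  have := Fintype.ofFinite (MapFace hα σ)
  have hcyc : ∀ d d', σ.SameCycle d d' ↔ d.fst = d'.fst := fun d d' =>
    hσ.sameCycle_iff d (Finset.mem_univ _) d' (Finset.mem_univ _)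
  have hrot : ∀ d, (σ d).fst = d.fst := fun d =>
    (hcyc _ _).1 (Perm.sameCycle_apply_left.2 (.refl _ _))
  -- the neighbours of a vertex of `H`
  have hnbr : ∀ x y, (completeBipartiteGraph (Fin 3) (Fin 5)).Adj (φ x) y →
      ∃ d : H.Dart, d.fst = x ∧ φ d.snd = y := by
    intro x y hxy
    obtain ⟨z, hz, rfl⟩ := hloc x hxy
    exact ⟨⟨(x, z), hz⟩, rfl, rfl⟩
  let A : W → Prop := fun x => (φ x).isLeft = true
  have hA : ∀ d : H.Dart, A d.snd ↔ ¬ A d.fst := by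
    intro d
    have h := φ.map_adj d.adj
    simp only [completeBipartiteGraph_adj] at h
    simp only [A]
    rcases h with ⟨h1, h2⟩ | ⟨h1, h2⟩
    · cases hx : φ d.snd <;> simp_all
    · cases hx : φ d.fst <;> simp_all
  let P : H.Dart → Prop := fun d => A d.fst
  have hPα : ∀ d : H.Dart, P d.symm ↔ ¬ P d := hA
  have hPσ : ∀ d, P (σ d) ↔ P d := fun d => by simp only [P, hrot]
  let out : W → Finset H.Dart := fun x => {d | d.fst = x}
  have hout : ∀ x d, d ∈ out x ↔ d.fst = x := fun x d => by simp [out]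
  have hcolA : ∀ x, A x → ∀ j, ∃ d ∈ out x, φ d.snd = Sum.inr j := by
    intro x hx j
    obtain ⟨d, hd, hd'⟩ := hnbr x (Sum.inr j) (by
      simp only [A] at hx
      simp [hx])
    exact ⟨d, (hout x d).2 hd, hd'⟩
  have hcolB : ∀ x, ¬ A x → ∀ i, ∃ d ∈ out x, φ d.snd = Sum.inl i := by
    intro x hx i
    obtain ⟨d, hd, hd'⟩ := hnbr x (Sum.inl i) (by
      simp only [A] at hx
      cases h : φ x <;> simp_all)
    exact ⟨d, (hout x d).2 hd, hd'⟩
  have hcycle : ∀ (d₀ : H.Dart), ∀ d, d ∈ out d₀.fst ↔ σ.SameCycle d₀ d := fun d₀ d => by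
    rw [hout, hcyc, eq_comm]
  have hcard : ∀ x, A x → 5 ≤ (out x).card := by
    intro x hx
    have h1 : (Finset.univ.image (Sum.inr : Fin 5 → Fin 3 ⊕ Fin 5)) ⊆
        (out x).image fun d => φ d.snd := by
      intro y hy
      obtain ⟨j, -, rfl⟩ := Finset.mem_image.1 hy
      exact Finset.mem_image.2 (hcolA x hx j)
    have h2 := (Finset.card_le_card h1).trans Finset.card_image_le
    rwa [Finset.card_image_of_injective _ Sum.inr_injective, Finset.card_univ,
      Fintype.card_fin] at h2
  -- no vertex has degree one, so that there are no digons
  have hmove : ∀ d, σ d ≠ d := by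
    intro d hd
    have hone : ∀ d' ∈ out d.fst, d' = d := fun d' hd' =>
      ((((hcycle d d').1 hd').eq_of_left hd)).symm
    by_cases hx : A d.fst
    · obtain ⟨d₁, h1, h1'⟩ := hcolA _ hx 0
      obtain ⟨d₂, h2, h2'⟩ := hcolA _ hx 1
      rw [hone d₁ h1] at h1'
      rw [hone d₂ h2, h1'] at h2'
      simp at h2'
    · obtain ⟨d₁, h1, h1'⟩ := hcolB _ hx 0
      obtain ⟨d₂, h2, h2'⟩ := hcolB _ hx 1
      rw [hone d₁ h1] at h1'
      rw [hone d₂ h2, h1'] at h2'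
      simp at h2'
  have hdigon : ∀ d, ψ (ψ d) ≠ d := by
    intro d hd
    refine hmove d (SimpleGraph.Dart.ext _ _ (Prod.ext (hrot d) ?_))
    have h1 : (σ (σ d).symm).fst = (σ d).symm.fst := hrot _
    have h2 : σ (σ d).symm = d.symm := by
      rw [hψ, hψ] at hd
      rw [← hd, SimpleGraph.Dart.symm_symm, hd]
    rw [h2] at h1
    exact h1.symm
  -- the colour of the end of a dart; the value `0` at ends over `Fin 5` plays no role
  let κ : H.Dart → Fin 3 := fun d => (φ d.snd).elim id fun _ => 0
  let w : H.Dart → ℕ := fun d => cornerWeight (κ (σ⁻¹ d)) (κ d) (κ (σ d))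
  have hB : ∀ x, ¬ A x → ∑ d ∈ out x, w d + 12 ≤ 4 * (out x).card := by
    intro x hx
    obtain ⟨d₀, hd₀, -⟩ := hcolB x hx 0
    obtain rfl := (hout _ _).1 hd₀
    refine sum_cornerWeight_add_le (hcycle d₀) fun k => ?_
    obtain ⟨d, hd, hd'⟩ := hcolB _ hx k
    exact ⟨d, hd, by simp [κ, hd']⟩
  have hκ : ∀ d d' : H.Dart, σ.SameCycle d d' → κ d.symm = κ d'.symm := by
    intro d d' h
    have h1 : d.symm.snd = d'.symm.snd := (hcyc d d').1 h
    simp only [κ, h1]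
  let u : H.Dart → ℕ := fun d => if (ψ ^ 4) d = d then 3 else 2
  have hu : ∀ d, u d ≤ 3 := by
    intro d
    simp only [u]
    split_ifs <;> omega
  have hAv : ∀ x, A x → 12 + 2 * ∑ d ∈ out x, u d ≤ 8 * (out x).card + ∑ d ∈ out x, w d.symm := by
    intro x hx
    have h5 := hcard x hx
    have hsum3 : ∑ d ∈ out x, u d ≤ (out x).card * 3 :=
      Finset.sum_le_card_nsmul _ _ 3 fun d _ => hu d
    rcases h5.lt_or_eq with h6 | h6
    · omega
    by_cases hall : ∀ d ∈ out x, (ψ ^ 4) d = d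
    · obtain ⟨d₀, hd₀, -⟩ := hcolA x hx 0
      obtain rfl := (hout _ _).1 hd₀
      have h2 : 2 ≤ ∑ d ∈ out d₀.fst, w d.symm :=
        two_le_sum_cornerWeight_of_quadrangles hα hκ (hcycle d₀) h6.symm hall
      omega
    · push Not at hall
      obtain ⟨d, hd, hne⟩ := hall
      have h1 : ∑ e ∈ out x, u e < (out x).card * 3 := by
        rw [← smul_eq_mul, ← Finset.sum_const]
        refine Finset.sum_lt_sum (fun e _ => hu e) ⟨d, hd, ?_⟩
        simp [u, hne]
      omega
  -- the charges are summed over the two sides and compared with Euler's inequality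
  have hfaces : 6 * Fintype.card (MapFace hα σ) ≤ ∑ d with P d, u d := by
    convert six_mul_card_mapFace_le hα (fun d => (hPα _).trans (not_congr (hPσ d))) hdigon
  have hne : Nonempty H.Dart := by
    obtain ⟨x, hx⟩ := hsurj (Sum.inl 0)
    obtain ⟨d, -⟩ := hcolA x (by simp [A, hx]) 0
    exact ⟨d⟩
  have heuler : Fintype.card {d // P d} + 2 ≤ Fintype.card W + Fintype.card (MapFace hα σ) := by
    convert hσ.euler hα hPα
  have hfibA : ∀ g : H.Dart → ℕ, ∑ x with A x, ∑ d ∈ out x, g d = ∑ d with P d, g d := fun g => by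
    convert SimpleGraph.sum_filter_sum_darts A g
  have hfibB : ∀ g : H.Dart → ℕ, ∑ x with ¬ A x, ∑ d ∈ out x, g d = ∑ d with ¬ P d, g d :=
    fun g => by convert SimpleGraph.sum_filter_sum_darts (fun x => ¬ A x) g
  have hswap : ∀ g : H.Dart → ℕ, ∑ d with P d, g d.symm = ∑ d with ¬ P d, g d := by
    intro g
    refine Finset.sum_equiv hα.toPerm (fun d => ?_) fun _ _ => rfl
    simp only [Finset.mem_filter, Finset.mem_univ, true_and]
    change P d ↔ ¬ P d.symm
    rw [hPα, not_not]
  have hsumA := Finset.sum_le_sum fun x (hx : x ∈ ({x | A x} : Finset W)) =>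
    hAv x (Finset.mem_filter.1 hx).2
  have hsumB := Finset.sum_le_sum fun x (hx : x ∈ ({x | ¬ A x} : Finset W)) =>
    hB x (Finset.mem_filter.1 hx).2
  have hconst : ∀ s : Finset W, ∑ _x ∈ s, 12 = 12 * s.card := fun s => by
    rw [Finset.sum_const, smul_eq_mul, mul_comm]
  simp only [Finset.sum_add_distrib, ← Finset.mul_sum, hconst] at hsumA hsumB
  simp only [Finset.card_eq_sum_ones (out _), hfibA, hfibB] at hsumA hsumB
  rw [hswap w] at hsumA
  have hcardW : ({x | A x} : Finset W).card + ({x | ¬ A x} : Finset W).card = Fintype.card W := by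
    convert Finset.card_filter_add_card_filter_not (s := (Finset.univ : Finset W)) A
    exact Finset.card_univ.symm
  have hcardP : ∑ d : H.Dart with P d, 1 = Fintype.card {d // P d} := by
    rw [Fintype.card_subtype, Finset.card_eq_sum_ones]
  have hcardD := hswap fun _ => 1
  omega
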